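/- **Conventions.** Nets are indexed by $\varepsilon\in\,]0,1]$, and asymptotics are for $\varepsilon\to0$. A net of real numbers $(\lambda_\varepsilon)$ is *slow scaled* if there is $\varepsilon'\in\,]0,1]$ such that for every $t\ge 0$ there is $C_t>0$ with $|\lambda_\varepsilon|^t\le C_t\varepsilon^{-1}$ for all $\varepsilon\le\varepsilon'$. Let $\mathcal T$ be the set of maps $\tau:\,]0,1]\to\,]0,1]$ with $\tau(\varepsilon)\to0$ as $\varepsilon\to 0$. *Colombeau functions.* For $\Omega\subseteq\mathbb R^d$ open, $\mathcal G(\Omega)$ is the quotient of the moderate nets $(u_\varepsilon)$ of smooth complex-valued functions on $\Omega$ (for all $K\Subset\Omega$ and $\alpha\in\mathbb N^d$ there is $p$ with $\sup_K|\partial^\alpha u_\varepsilon|=O(\varepsilon^{-p})$) by the negligible ones (moderate nets with $\sup_K|u_\varepsilon|=O(\varepsilon^q)$ for all $K\Subset\Omega$ and all $q$). Generalized numbers $\widetilde{\mathbb C}$ are defined in the same way from nets of complex numbers and are regarded as constant elements of $\mathcal G(\Omega)$. The support $\operatorname{supp}(u)$ is the complement in $\Omega$ of the union of all open $W\subseteq\Omega$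 with $u|_W=0$ in $\mathcal G(W)$. *Wave front set.* For $v\in\mathcal G(\Omega)$ with compact support, $\Sigma(v)\subseteq S^{d-1}$ is the complement of the set of all $\xi_0\in S^{d-1}$ having an open neighbourhood $\Gamma\subseteq S^{d-1}$ such that, for some representative $(v_\varepsilon)$ of $v$ whose members are supported in a joint compact subset of $\Omega$, there is $N\in\mathbb N$ such that for all $p\in\mathbb N$ $$\sup_{\lambda>0,\ \xi\in\Gamma}(1+\lambda^2)^{p/2}|\widehat{v_\varepsilon}(\lambda\xi)|=O(\varepsilon^{-N}),\qquad \widehat{v_\varepsilon}(\xi)=\int_\Omega v_\varepsilon(x)e^{-i\langle x,\xi\rangle}\,dx .$$ For $u\in\mathcal G(\Omega)$, $$WF(u)=\Big\{(x,\xi)\in\Omega\times S^{d-1} : \xi\in\Sigma(\varphi u)\text{ for all }\varphi\in C_c^\infty(\Omega)\text{ with }\varphi(x)\neq0\Big\}.$$ **Setting.** Let $\Omega_1\subseteq\mathbb R^n$ and $\Omega_2\subseteq\mathbb R^m$ be open. Let $f$ be a c-bounded Colombeau map from $\Omega_1$ to $\Omega_2$, i.e. an element of the $m$-fold product of the real-valued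 Colombeau algebra on $\Omega_1$ having a *c-bounded* representative: one consisting of smooth maps $f_\varepsilon:\Omega_1\to\Omega_2$ such that for every $K\Subset\Omega_1$ there is $K'\Subset\Omega_2$ with $f_\varepsilon(K)\subseteq K'$ for all $\varepsilon\in\,]0,1]$. Fix any such representative $(f_\varepsilon)$. Write ${}^T\!df_\varepsilon(x)$ for the transposed Jacobian. * For a net of maps $F_\varepsilon:D\to R$, the generalized graph $\mathcal C_F$ is the set of $(x,y)\in D\times R$ for which there are a net $(x_\varepsilon)$ in $D$ with $x_\varepsilon\to x$ and $\tau\in\mathcal T$ such that $y$ is a cluster point of $(F_{\tau(\varepsilon)}(x_\varepsilon))_\varepsilon$ as $\varepsilon\to0$. * $D_f$ is the set of $(x_0,\eta_0)\in\Omega_1\times S^{m-1}$ having a neighbourhood $X\times V\subseteq\Omega_1\times S^{m-1}$ for which there are a positive slow scaled net $(\sigma_\varepsilon)$, $\alpha,\beta\in\,]0,\infty[$ and $\varepsilon'\in\,]0,1]$ such that, for all $\varepsilon<\varepsilon'$, $|\sigma_\varepsilon{}^T\!df_\varepsilon(x)\eta|\ge\alpha$ for $(x,\eta)\in X\times V$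 and $|\sigma_\varepsilon{}^T\!df_\varepsilon(x)\eta|\le\beta$ for $(x,\eta)\in X\times V^\perp$, where $V^\perp=\{\eta\in S^{m-1}:\langle\eta,\eta'\rangle=0\text{ for some }\eta'\in V\}$. * For $\Gamma\subseteq\Omega_2\times S^{m-1}$, the wave front unfavorable support $U_f(\Gamma)$ of $f$ with respect to $\Gamma$ is the set of $x\in\Omega_1$ for which there are $y,\eta$ with $(x,y)\in\mathcal C_f$, $(x,\eta)\notin D_f$ and $(y,\eta)\in\Gamma$. * Let $M_\varepsilon(x,\eta)={}^T\!df_\varepsilon(x)\eta/|{}^T\!df_\varepsilon(x)\eta|\in S^{n-1}$ for $(x,\eta)\in D_f$ (defined locally for small $\varepsilon$). If $D_f\ne\emptyset$, then $f^*\Gamma$ is the set of $(x,\xi)\in\Omega_1\times S^{n-1}$ for which there are $y,\eta$ with $(x,y)\in\mathcal C_f$, $(y,\eta)\in\Gamma$, $(x,\eta)\in D_f$ and $((x,\eta),\xi)\in\mathcal C_M$. If $D_f=\emptyset$, then $f^*\Gamma=\Omega_1\times S^{n-1}$. * $S^f$ is the set of $x_0\in\Omega_1$ having a neighbourhood $X_0\subseteq\Omega_1$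 such that for every $\alpha\in\mathbb N^n$ there are a slow scaled net $(r_\varepsilon)$ and a constant $C$ with $\sup_{X_0}|\partial^\alpha f_\varepsilon|\le C r_\varepsilon$ for all small $\varepsilon$; $(S^f)^c$ is its complement. * $K^f(u)=\bigcap_{k\in\widetilde{\mathbb C}}\pi_1\big(\mathcal C_f\cap(\Omega_1\times\operatorname{supp}(u-k))\big)$ for $u\in\mathcal G(\Omega_2)$, where $\pi_1$ is the projection to $\Omega_1$. **Theorem.** For every $u\in\mathcal G(\Omega_2)$ the pullback $f^*u=[(u_\varepsilon\circ f_\varepsilon)_\varepsilon]\in\mathcal G(\Omega_1)$ is well defined: the net is moderate, and its class depends neither on the representative $(u_\varepsilon)$ of $u$ nor on the c-bounded representative of $f$. Moreover, $$WF(f^*u)\subseteq f^*WF(u)\ \cup\ \big(U_f(WF(u))\times S^{n-1}\big)\ \cup\ \big((K^f(u)\cap(S^f)^c)\times S^{n-1}\big).$$ -/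

import Mathlib

open Set Filter Topology
open scoped ContDiff InnerProductSpace

noncomputable section

namespace ColombeauWF

/-! ### Nets indexed by `]0,1]` -/

/-- The index set `]0,1]`. -/
abbrev Eps : Type := Set.Ioc (0 : ℝ) 1

/-- The filter on `]0,1]` describing `ε → 0`. -/
def toZero : Filter Eps := comap (fun ε : Eps => (ε : ℝ)) (𝓝 0)

/-- The Euclidean space `ℝⁿ`. -/
abbrev EucSp (n : ℕ) : Type := EuclideanSpace ℝ (Fin n)

/-- The unit sphere `S^{n-1}` of `ℝⁿ`. -/
abbrev USphere (n : ℕ) : Type := Metric.sphere (0 : EucSp n) 1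

/-- A net of real numbers is slow scaled if, on some interval `]0,ε']`, each power `|l_ε|^t`, `t ≥ 0`,
is bounded by a constant times `ε⁻¹`. -/
def SlowScaled (l : Eps → ℝ) : Prop :=
  ∃ ε' : Eps, ∀ t : ℝ, 0 ≤ t → ∃ C : ℝ, 0 < C ∧
    ∀ ε : Eps, ε ≤ ε' → |l ε| ^ t ≤ C * (ε : ℝ)⁻¹

/-! ### Colombeau algebras -/

section Algebra

variable {E : Type*} [NormedAddCommGroup E] [NormedSpace ℝ E]
variable {F : Type*} [NormedAddCommGroup F] [NormedSpace ℝ F]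

/-- Moderate nets of smooth functions on the open set `Ω` with values in `F`. The functions are
total, but only their values on `Ω` matter. All partial derivatives of order `k` are controlled
by the operator norm of the `k`-th total derivative, and conversely. -/
def IsModerate (Ω : Set E) (r : Eps → E → F) : Prop :=
  (∀ ε, ContDiffOn ℝ ∞ (r ε) Ω) ∧
    ∀ K : Set E, IsCompact K → K ⊆ Ω → ∀ k : ℕ, ∃ (N : ℕ) (C : ℝ), ∀ᶠ ε in toZero, ∀ x ∈ K,
      ‖iteratedFDeriv ℝ k (r ε) x‖ ≤ C * (ε : ℝ)⁻¹ ^ N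

/-- The estimates `sup_K |r_ε| = O(ε^q)`, for all compact subsets `K` of `Ω` and all `q`. -/
def IsNegligible (Ω : Set E) (r : Eps → E → F) : Prop :=
  ∀ K : Set E, IsCompact K → K ⊆ Ω → ∀ q : ℕ, ∃ C : ℝ, ∀ᶠ ε in toZero, ∀ x ∈ K,
    ‖r ε x‖ ≤ C * (ε : ℝ) ^ q

lemma pow_inv_le_pow_inv {ε : Eps} {a b : ℕ} (h : a ≤ b) :
    (ε : ℝ)⁻¹ ^ a ≤ (ε : ℝ)⁻¹ ^ b :=
  pow_le_pow_right₀ ((one_le_inv₀ ε.2.1).2 ε.2.2) h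

lemma mul_pow_inv_le {ε : Eps} {C : ℝ} {a b : ℕ} (h : a ≤ b) :
    C * (ε : ℝ)⁻¹ ^ a ≤ |C| * (ε : ℝ)⁻¹ ^ b := by
  have h0 : (0 : ℝ) ≤ (ε : ℝ)⁻¹ ^ a := pow_nonneg (inv_nonneg.2 ε.2.1.le) _
  exact (mul_le_mul_of_nonneg_right (le_abs_self C) h0).trans
    (mul_le_mul_of_nonneg_left (pow_inv_le_pow_inv h) (abs_nonneg C))

/-- The additive group of moderate nets on `Ω`. -/
def moderateNets (Ω : TopologicalSpace.Opens E) (F : Type*) [NormedAddCommGroup F]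
    [NormedSpace ℝ F] : AddSubgroup (Eps → E → F) where
  carrier := {r | IsModerate (Ω : Set E) r}
  zero_mem' := by
    refine ⟨fun ε => contDiffOn_const, fun K _ _ k => ⟨0, 0, Eventually.of_forall ?_⟩⟩
    intro ε x _
    simp
  add_mem' := by
    rintro r s ⟨hr, hr'⟩ ⟨hs, hs'⟩
    refine ⟨fun ε => (hr ε).add (hs ε), fun K hK hKΩ k => ?_⟩
    obtain ⟨N, C, hC⟩ := hr' K hK hKΩ k
    obtain ⟨M, D, hD⟩ := hs' K hK hKΩ k
    refine ⟨max N M, |C| + |D|, ?_⟩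
    filter_upwards [hC, hD] with ε h1 h2 x hx
    have hxΩ : (Ω : Set E) ∈ 𝓝 x := Ω.isOpen.mem_nhds (hKΩ hx)
    have e : iteratedFDeriv ℝ k ((r + s) ε) x
        = iteratedFDeriv ℝ k (r ε) x + iteratedFDeriv ℝ k (s ε) x :=
      iteratedFDeriv_add_apply (((hr ε).contDiffAt hxΩ).of_le (by exact_mod_cast le_top))
        (((hs ε).contDiffAt hxΩ).of_le (by exact_mod_cast le_top))
    rw [e, add_mul]
    exact (norm_add_le _ _).trans (add_le_add
      ((h1 x hx).trans (mul_pow_inv_le (le_max_left _ _)))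
      ((h2 x hx).trans (mul_pow_inv_le (le_max_right _ _))))
  neg_mem' := by
    rintro r ⟨hr, hr'⟩
    refine ⟨fun ε => (hr ε).neg, fun K hK hKΩ k => ?_⟩
    obtain ⟨N, C, hC⟩ := hr' K hK hKΩ k
    refine ⟨N, C, ?_⟩
    filter_upwards [hC] with ε h1 x hx
    have e : iteratedFDeriv ℝ k ((-r) ε) x = -iteratedFDeriv ℝ k (r ε) x :=
      iteratedFDeriv_neg_apply
    rw [e, norm_neg]
    exact h1 x hx

/-- The subgroup of negligible nets inside the moderate nets. -/
def negligibleNets (Ω : TopologicalSpace.Opens E) (F : Type*) [NormedAddCommGroup F]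
    [NormedSpace ℝ F] : AddSubgroup (moderateNets Ω F) where
  carrier := {r | IsNegligible (Ω : Set E) (r : Eps → E → F)}
  zero_mem' := by
    intro K _ _ q
    exact ⟨0, Eventually.of_forall fun ε x _ => by simp⟩
  add_mem' := by
    intro r s hr hs K hK hKΩ q
    obtain ⟨C, hC⟩ := hr K hK hKΩ q
    obtain ⟨D, hD⟩ := hs K hK hKΩ q
    refine ⟨C + D, ?_⟩
    filter_upwards [hC, hD] with ε h1 h2 x hx
    rw [add_mul]
    exact (norm_add_le _ _).trans (add_le_add (h1 x hx) (h2 x hx))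
  neg_mem' := by
    intro r hr K hK hKΩ q
    obtain ⟨C, hC⟩ := hr K hK hKΩ q
    refine ⟨C, ?_⟩
    filter_upwards [hC] with ε h1 x hx
    have e : ‖((-r : moderateNets Ω F) : Eps → E → F) ε x‖ = ‖(r : Eps → E → F) ε x‖ :=
      norm_neg _
    rw [e]
    exact h1 x hx

/-- The (special) Colombeau space `𝒢(Ω)` of generalized functions with values in `F`: moderate
nets modulo negligible nets. For `F = ℂ` it is the Colombeau algebra, for `F = ℝᵐ` it is the
`m`-fold product of the real Colombeau algebra. -/
abbrev Colombeau (Ω : TopologicalSpace.Opens E) (F : Type*) [NormedAddCommGroup F]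
    [NormedSpace ℝ F] : Type _ :=
  moderateNets Ω F ⧸ negligibleNets Ω F

/-- The net `r` is a representative of `u`. -/
def IsRep {Ω : TopologicalSpace.Opens E} (u : Colombeau Ω F) (r : Eps → E → F) : Prop :=
  ∃ h : r ∈ moderateNets Ω F, (QuotientAddGroup.mk ⟨r, h⟩ : Colombeau Ω F) = u

/-! ### Products with smooth functions -/

lemma smoothMul_mem (Ω : TopologicalSpace.Opens E) (φ : E → ℂ) (hφ : ContDiff ℝ ∞ φ)
    {r : Eps → E → ℂ} (hr : r ∈ moderateNets Ω ℂ) :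
    (fun ε x => φ x * r ε x) ∈ moderateNets Ω ℂ := by
  obtain ⟨h1, h2⟩ := hr
  refine ⟨fun ε => hφ.contDiffOn.mul (h1 ε), fun K hK hKΩ k => ?_⟩
  choose N C hC using h2 K hK hKΩ
  have hb : ∀ i : ℕ, ∃ B : ℝ, ∀ x ∈ K, ‖iteratedFDeriv ℝ i φ x‖ ≤ B := fun i =>
    hK.exists_bound_of_continuousOn
      (hφ.continuous_iteratedFDeriv (by exact_mod_cast le_top)).continuousOn
  choose B hB using hb
  refine ⟨(Finset.range (k + 1)).sup N,
    ∑ i ∈ Finset.range (k + 1), (k.choose i : ℝ) * |B i| * |C (k - i)|, ?_⟩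
  have hall : ∀ᶠ ε in toZero, ∀ j ∈ Finset.range (k + 1), ∀ x ∈ K,
      ‖iteratedFDeriv ℝ j (r ε) x‖ ≤ C j * (ε : ℝ)⁻¹ ^ N j :=
    (Finset.eventually_all _).2 fun j _ => hC j
  filter_upwards [hall] with ε hε x hx
  have hU := Ω.isOpen.uniqueDiffOn (𝕜 := ℝ)
  have hb := norm_iteratedFDerivWithin_mul_le (𝕜 := ℝ) (N := (∞ : WithTop ℕ∞))
    (hφ.contDiffOn (s := (Ω : Set E))) (h1 ε) hU (hKΩ hx) (n := k) (by exact_mod_cast le_top)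
  simp only [iteratedFDerivWithin_of_isOpen _ Ω.isOpen (hKΩ hx)] at hb
  refine hb.trans ?_
  rw [Finset.sum_mul]
  refine Finset.sum_le_sum fun i hi => ?_
  have hki : k - i ∈ Finset.range (k + 1) := Finset.mem_range.2 (by omega)
  have e1 := (hε _ hki x hx).trans
    (mul_pow_inv_le (ε := ε) (C := C (k - i)) (Finset.le_sup (f := N) hki))
  have e2 := (hB i x hx).trans (le_abs_self _)
  rw [mul_assoc, mul_assoc, mul_assoc]
  refine mul_le_mul_of_nonneg_left ?_ (Nat.cast_nonneg _)
  exact mul_le_mul e2 e1 (norm_nonneg _) (abs_nonneg _)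

/-- Multiplication with a smooth function, on moderate nets. -/
def smoothMulNets (Ω : TopologicalSpace.Opens E) (φ : E → ℂ) (hφ : ContDiff ℝ ∞ φ) :
    moderateNets Ω ℂ →+ moderateNets Ω ℂ where
  toFun r := ⟨fun ε x => φ x * (r : Eps → E → ℂ) ε x, smoothMul_mem Ω φ hφ r.2⟩
  map_zero' := by
    ext ε x
    simp
  map_add' r s := by
    ext ε x
    simp [mul_add]

lemma negligible_le_comap_smoothMulNets (Ω : TopologicalSpace.Opens E) (φ : E → ℂ)
    (hφ : ContDiff ℝ ∞ φ) :
    negligibleNets Ω ℂ ≤ (negligibleNets Ω ℂ).comap (smoothMulNets Ω φ hφ) := by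
  intro r hr K hK hKΩ q
  obtain ⟨B, hB⟩ := hK.exists_bound_of_continuousOn hφ.continuous.continuousOn
  obtain ⟨C, hC⟩ := hr K hK hKΩ q
  refine ⟨|B| * C, ?_⟩
  filter_upwards [hC] with ε h1 x hx
  have e : ‖(smoothMulNets Ω φ hφ r : Eps → E → ℂ) ε x‖ = ‖φ x‖ * ‖(r : Eps → E → ℂ) ε x‖ :=
    norm_mul _ _
  rw [e, mul_assoc]
  exact mul_le_mul ((hB x hx).trans (le_abs_self _)) (h1 x hx) (norm_nonneg _) (abs_nonneg _)

/-- The product `φ · u` of a smooth function and a Colombeau function. -/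
def smoothMul {Ω : TopologicalSpace.Opens E} (φ : E → ℂ) (hφ : ContDiff ℝ ∞ φ)
    (u : Colombeau Ω ℂ) : Colombeau Ω ℂ :=
  QuotientAddGroup.map _ _ (smoothMulNets Ω φ hφ) (negligible_le_comap_smoothMulNets Ω φ hφ) u

/-! ### Generalized numbers -/

/-- Moderate nets of complex numbers. -/
def moderateNumbers : AddSubgroup (Eps → ℂ) where
  carrier := {k | ∃ (N : ℕ) (C : ℝ), ∀ᶠ ε in toZero, ‖k ε‖ ≤ C * (ε : ℝ)⁻¹ ^ N}
  zero_mem' := ⟨0, 0, Eventually.of_forall fun ε => by simp⟩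
  add_mem' := by
    rintro r s ⟨N, C, hC⟩ ⟨M, D, hD⟩
    refine ⟨max N M, |C| + |D|, ?_⟩
    filter_upwards [hC, hD] with ε h1 h2
    rw [add_mul]
    exact (norm_add_le _ _).trans (add_le_add
      (h1.trans (mul_pow_inv_le (le_max_left _ _)))
      (h2.trans (mul_pow_inv_le (le_max_right _ _))))
  neg_mem' := by
    rintro r ⟨N, C, hC⟩
    refine ⟨N, C, ?_⟩
    filter_upwards [hC] with ε h1
    simpa using h1

/-- Negligible nets of complex numbers. -/
def negligibleNumbers : AddSubgroup moderateNumbers where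
  carrier := {k | ∀ q : ℕ, ∃ C : ℝ, ∀ᶠ ε in toZero, ‖(k : Eps → ℂ) ε‖ ≤ C * (ε : ℝ) ^ q}
  zero_mem' := fun q => ⟨0, Eventually.of_forall fun ε => by simp⟩
  add_mem' := by
    intro r s hr hs q
    obtain ⟨C, hC⟩ := hr q
    obtain ⟨D, hD⟩ := hs q
    refine ⟨C + D, ?_⟩
    filter_upwards [hC, hD] with ε h1 h2
    rw [add_mul]
    exact (norm_add_le _ _).trans (add_le_add h1 h2)
  neg_mem' := by
    intro r hr q
    obtain ⟨C, hC⟩ := hr q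
    refine ⟨C, ?_⟩
    filter_upwards [hC] with ε h1
    simpa using h1

/-- The (complex) generalized numbers. -/
abbrev GenNumber : Type := moderateNumbers ⧸ negligibleNumbers

lemma constNet_mem (Ω : TopologicalSpace.Opens E) {k : Eps → ℂ} (hk : k ∈ moderateNumbers) :
    (fun ε (_ : E) => k ε) ∈ moderateNets Ω ℂ := by
  obtain ⟨N, C, hC⟩ := hk
  refine ⟨fun ε => contDiffOn_const, fun K _ _ j => ?_⟩
  rcases Nat.eq_zero_or_pos j with rfl | hj
  · refine ⟨N, C, ?_⟩
    filter_upwards [hC] with ε h x _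
    simpa using h
  · refine ⟨0, 0, Eventually.of_forall fun ε x _ => ?_⟩
    rw [iteratedFDeriv_const_of_ne hj.ne']
    simp

/-- Constant generalized functions, on moderate nets. -/
def constNets (Ω : TopologicalSpace.Opens E) : moderateNumbers →+ moderateNets Ω ℂ where
  toFun k := ⟨fun ε _ => (k : Eps → ℂ) ε, constNet_mem Ω k.2⟩
  map_zero' := rfl
  map_add' _ _ := rfl

lemma negligible_le_comap_constNets (Ω : TopologicalSpace.Opens E) :
    negligibleNumbers ≤ (negligibleNets Ω ℂ).comap (constNets Ω) := by
  intro k hk K _ _ q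
  obtain ⟨C, hC⟩ := hk q
  refine ⟨C, ?_⟩
  filter_upwards [hC] with ε h1 x _
  exact h1

/-- A generalized number, regarded as a constant generalized function on `Ω`. -/
def constFun (Ω : TopologicalSpace.Opens E) (k : GenNumber) : Colombeau Ω ℂ :=
  QuotientAddGroup.map _ _ (constNets Ω) (negligible_le_comap_constNets Ω) k

/-- The support of a Colombeau function: the complement in `Ω` of the union of all open subsets
of `Ω` on which it vanishes as a generalized function. -/
def gsupp {Ω : TopologicalSpace.Opens E} (u : Colombeau Ω ℂ) : Set E :=
  {y | y ∈ Ω ∧ ¬ ∃ W : Set E, IsOpen W ∧ y ∈ W ∧ W ⊆ Ω ∧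
    ∃ r : Eps → E → ℂ, IsRep u r ∧ IsNegligible W r}

end Algebra

/-! ### The generalized wave front set -/

/-- The Fourier transform `ξ ↦ ∫_Ω w(x) e^{-i⟨x,ξ⟩} dx`. -/
def fourierOn {n : ℕ} (Ω : Set (EucSp n)) (w : EucSp n → ℂ) (ξ : EucSp n) : ℂ :=
  ∫ x in Ω, w x * Complex.exp (-(Complex.I * ((⟪x, ξ⟫_ℝ : ℝ) : ℂ)))

/-- The net `g` of functions on `ℝⁿ` is rapidly decreasing in the directions in `Γ`, with an
order in `ε⁻¹` that does not depend on the rate of decrease `p`. -/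
def RapidlyDecreasing {n : ℕ} (g : Eps → EucSp n → ℂ) (Γ : Set (USphere n)) : Prop :=
  ∃ N : ℕ, ∀ p : ℕ, ∃ C : ℝ, ∀ᶠ ε in toZero, ∀ t : ℝ, 0 < t → ∀ ξ ∈ Γ,
    (1 + t ^ 2) ^ ((p : ℝ) / 2) * ‖g ε (t • (ξ : EucSp n))‖ ≤ C * (ε : ℝ)⁻¹ ^ N

/-- The set `Σ(v)` of irregular directions of a compactly supported Colombeau function `v`: the
complement of the directions that have an open neighbourhood in which the Fourier transform of
a representative of `v` with joint compact support is rapidly decreasing. -/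
def irregDir {n : ℕ} {Ω : TopologicalSpace.Opens (EucSp n)} (v : Colombeau Ω ℂ) :
    Set (USphere n) :=
  {ξ | ¬ ∃ Γ : Set (USphere n), IsOpen Γ ∧ ξ ∈ Γ ∧
    ∃ w : Eps → EucSp n → ℂ, IsRep v w ∧
      (∃ K : Set (EucSp n), IsCompact K ∧ K ⊆ Ω ∧ ∀ ε, ∀ x ∈ Ω, x ∉ K → w ε x = 0) ∧
      RapidlyDecreasing (fun ε => fourierOn Ω (w ε)) Γ}

/-- The cone `Σ_x(u)` of irregular directions of `u` at `x`. -/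
def irregDirAt {n : ℕ} {Ω : TopologicalSpace.Opens (EucSp n)} (u : Colombeau Ω ℂ)
    (x : EucSp n) : Set (USphere n) :=
  {ξ | ∀ (φ : EucSp n → ℂ) (hφ : ContDiff ℝ ∞ φ), HasCompactSupport φ → tsupport φ ⊆ Ω →
    φ x ≠ 0 → ξ ∈ irregDir (smoothMul φ hφ u)}

/-- The generalized wave front set. -/
def WF {n : ℕ} {Ω : TopologicalSpace.Opens (EucSp n)} (u : Colombeau Ω ℂ) :
    Set (EucSp n × USphere n) :=
  {p | p.1 ∈ Ω ∧ p.2 ∈ irregDirAt u p.1}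

/-! ### c-bounded maps, pullbacks and generalized graphs -/

/-- The net `f` is a c-bounded representative (into `Ω₂`) of the generalized map `g`. The
inclusions for one-point sets `K` show that each `f_ε` maps `Ω₁` into `Ω₂`. -/
def IsCBoundedRep {n m : ℕ} {Ω₁ : TopologicalSpace.Opens (EucSp n)}
    (Ω₂ : TopologicalSpace.Opens (EucSp m)) (g : Colombeau Ω₁ (EucSp m))
    (f : Eps → EucSp n → EucSp m) : Prop :=
  IsRep g f ∧ ∀ K : Set (EucSp n), IsCompact K → K ⊆ Ω₁ →
    ∃ K' : Set (EucSp m), IsCompact K' ∧ K' ⊆ Ω₂ ∧ ∀ ε, MapsTo (f ε) K K'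

/-- `v` is the class of `(u_ε ∘ f_ε)`, for all representatives `(u_ε)` of `u` and all
c-bounded representatives `(f_ε)` of `g`. -/
def IsPullback {n m : ℕ} {Ω₁ : TopologicalSpace.Opens (EucSp n)}
    {Ω₂ : TopologicalSpace.Opens (EucSp m)} (g : Colombeau Ω₁ (EucSp m))
    (u : Colombeau Ω₂ ℂ) (v : Colombeau Ω₁ ℂ) : Prop :=
  ∀ (f : Eps → EucSp n → EucSp m) (r : Eps → EucSp m → ℂ),
    IsCBoundedRep Ω₂ g f → IsRep u r → IsRep v (fun ε x => r ε (f ε x))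

/-- The generalized graph, in `D × R`, of a net of maps defined on `D`: all `(x,y)` for which
there are a net `x_ε → x` in `D` and a map `τ` of `]0,1]` into itself with `τ(ε) → 0` such that
`y` is a cluster point of `F_{τ(ε)}(x_ε)` as `ε → 0`. -/
def genGraph {A B : Type*} [TopologicalSpace A] [TopologicalSpace B] (D : Set A) (R : Set B)
    (F : Eps → A → B) : Set (A × B) :=
  {p | p.1 ∈ D ∧ p.2 ∈ R ∧ ∃ a : Eps → A, (∀ ε, a ε ∈ D) ∧ Tendsto a toZero (𝓝 p.1) ∧
    ∃ τ : Eps → Eps, Tendsto τ toZero toZero ∧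
      MapClusterPt p.2 toZero (fun ε => F (τ ε) (a ε))}

section Sets

variable {n m : ℕ}

/-- The transposed Jacobian of `h` at `x`. -/
def transJac (h : EucSp n → EucSp m) (x : EucSp n) : EucSp m →L[ℝ] EucSp n :=
  ContinuousLinearMap.adjoint (fderiv ℝ h x)

/-- The set `V^⊥` of all unit vectors orthogonal to some element of `V`. -/
def perpSet (V : Set (USphere m)) : Set (USphere m) :=
  {η | ∃ η₀ ∈ V, ⟪(η : EucSp m), (η₀ : EucSp m)⟫_ℝ = 0}

/-- The open set `D_f` of `Ω₁ × S^{m-1}`. -/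
def domSet (Ω₁ : TopologicalSpace.Opens (EucSp n)) (f : Eps → EucSp n → EucSp m) :
    Set (EucSp n × USphere m) :=
  {p | p.1 ∈ Ω₁ ∧ ∃ X ∈ 𝓝 p.1, X ⊆ Ω₁ ∧ ∃ V ∈ 𝓝 p.2,
    ∃ σ : Eps → ℝ, (∀ ε, 0 < σ ε) ∧ SlowScaled σ ∧
      ∃ α β : ℝ, 0 < α ∧ 0 < β ∧ ∀ᶠ ε in toZero,
        (∀ x ∈ X, ∀ η ∈ V, α ≤ ‖σ ε • transJac (f ε) x (η : EucSp m)‖) ∧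
        (∀ x ∈ X, ∀ η ∈ perpSet V, ‖σ ε • transJac (f ε) x (η : EucSp m)‖ ≤ β)}

/-- The wave front unfavorable support of `f` with respect to `Γ`. -/
def unfavSupp (Ω₁ : TopologicalSpace.Opens (EucSp n)) (Ω₂ : TopologicalSpace.Opens (EucSp m))
    (f : Eps → EucSp n → EucSp m) (Γ : Set (EucSp m × USphere m)) : Set (EucSp n) :=
  {x | ∃ (y : EucSp m) (η : USphere m), (x, y) ∈ genGraph (Ω₁ : Set (EucSp n)) Ω₂ f ∧
    (x, η) ∉ domSet Ω₁ f ∧ (y, η) ∈ Γ}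

/-- The normalized transposed Jacobians `(x,η) ↦ ᵗdf_ε(x)η / |ᵗdf_ε(x)η|`. Near a point of `D_f`
the denominator does not vanish for small `ε`. -/
def normJac (f : Eps → EucSp n → EucSp m) (ε : Eps) (p : EucSp n × USphere m) : EucSp n :=
  ‖transJac (f ε) p.1 (p.2 : EucSp m)‖⁻¹ • transJac (f ε) p.1 (p.2 : EucSp m)

/-- The transformed set `f^*Γ`: the composition of the generalized graph of the normalized
transposed Jacobians on `D_f` with `x ↦ {x} × ⋃ Γ_y`, the union over all `y` in the fibre of the
generalized graph of `f` over `x`. If `D_f` is empty it is all of `Ω₁ × S^{n-1}`. -/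
def pullSet (Ω₁ : TopologicalSpace.Opens (EucSp n)) (Ω₂ : TopologicalSpace.Opens (EucSp m))
    (f : Eps → EucSp n → EucSp m) (Γ : Set (EucSp m × USphere m)) :
    Set (EucSp n × USphere n) :=
  {p | p.1 ∈ Ω₁ ∧ (domSet Ω₁ f = ∅ ∨
    ∃ (y : EucSp m) (η : USphere m), (p.1, y) ∈ genGraph (Ω₁ : Set (EucSp n)) Ω₂ f ∧
      (y, η) ∈ Γ ∧
      ((p.1, η), (p.2 : EucSp n)) ∈
        genGraph (domSet Ω₁ f) (Metric.sphere (0 : EucSp n) 1) (normJac f))}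

/-- The set `S^f` of all points at which `f` is slow scaled in all derivatives. -/
def slowSet (Ω₁ : TopologicalSpace.Opens (EucSp n)) (f : Eps → EucSp n → EucSp m) :
    Set (EucSp n) :=
  {x | x ∈ Ω₁ ∧ ∃ X ∈ 𝓝 x, X ⊆ Ω₁ ∧ ∀ k : ℕ, ∃ (s : Eps → ℝ) (C : ℝ), SlowScaled s ∧
    ∀ᶠ ε in toZero, ∀ x' ∈ X, ‖iteratedFDeriv ℝ k (f ε) x'‖ ≤ C * s ε}

/-- The set `K^f(u)`: the intersection over all generalized numbers `k` of the projections to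
`Ω₁` of the part of the generalized graph of `f` that lies over the support of `u - k`. -/
def nonconstSet (Ω₁ : TopologicalSpace.Opens (EucSp n)) {Ω₂ : TopologicalSpace.Opens (EucSp m)}
    (f : Eps → EucSp n → EucSp m) (u : Colombeau Ω₂ ℂ) : Set (EucSp n) :=
  ⋂ k : GenNumber,
    Prod.fst '' (genGraph (Ω₁ : Set (EucSp n)) Ω₂ f ∩
      (Ω₁ : Set (EucSp n)) ×ˢ gsupp (u - constFun Ω₂ k))

end Sets

end ColombeauWF

end

/-!
Microlocal regularity of pullbacks of Colombeau functions under c-bounded maps.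

That the pullback exists and is unique is a matter of the chain rule (moderateness), of c-boundedness
(change of the representative of `u`) and of the mean value inequality (change of the representative
of `f`); see `existsUnique_isPullback`.

For the inclusion of wave front sets, fix a point `(x₀, ξ₀)` outside the right-hand side. If `x₀` is
not in `K^f(u)`, the generalized graph of `f` over `x₀` avoids the support of `u - k` for some
generalized number `k`, so the pullback equals `k` near `x₀` and all directions are regular
(`notMem_WF_of_notMem_nonconstSet`). Otherwise `x₀ ∈ S^f`, all derivatives of `f` have slow scaled
bounds near `x₀`, and a genuinely microlocal argument is needed (`notMem_WF_of_mem_slowSet`).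

Its analytic core is `rapidlyDecreasing_comp`. Fourier inversion writes the Fourier transform of
`ψ · (w_ε ∘ f_ε)` at `ζ` as the integral over `η` of the transform of `w_ε` at `η` against the
oscillatory integral with the phase `⟨f_ε(x), η⟩ - ⟨x, ζ⟩`. For directions of `η` in which `w` is
regular, the decay of its transform suffices, as long as `|ζ|` is at most a slow scaled multiple of
`|η|`. In all other cases the gradient `ᵗdf_ε(x)η - ζ` is at least `|η| + |ζ|` up to a slow scaled
factor, and integration by parts (`nonstationary_phase`) gains arbitrary powers of `|η| + |ζ|`. Its
constants are slow scaled, and hence cost a single factor `ε⁻¹` whatever the number of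
integrations; the transform of `w` is merely estimated by a fixed power of `ε⁻¹`. This is why the order
in `ε⁻¹` does not depend on the rate of decrease.

For irregular directions `η` of `u` over the fibre of `x₀`, the lower bound on the gradient is exactly
what membership in `D_f` and the exclusion of `ξ₀` from the limits of the normalized transposed
Jacobians provide (`exists_nonstationary`). The same core estimate, applied to the identity map, shows
that regular directions of `u` at `y` stay regular, in a uniform neighbourhood, for all cutoffs near
`y` (`exists_rapidlyDecreasing_cutoff`). Compactness of the sphere and of the values of `f_ε` near
`x₀` allows one to put the local estimates together.
-/

namespace ColombeauWF

open scoped FourierTransform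
open MeasureTheory

/-! ### Slow growth with respect to a filter -/

/-- A family of real numbers `s`, indexed by `ι` and considered along the filter `L`, grows slowly
with respect to the parameter `e : ι → ]0,1]` if each of its powers is eventually `O(e⁻¹)`. For
`ι = ]0,1]` and `L` describing `ε → 0`, slow scaled nets have this property. The larger index
sets allow uniformity in further parameters such as frequencies. -/
def SlowOn {ι : Type*} (L : Filter ι) (e : ι → Eps) (s : ι → ℝ) : Prop :=
  ∀ t : ℕ, ∃ C : ℝ, ∀ᶠ i in L, |s i| ^ t ≤ C * (e i : ℝ)⁻¹

lemma one_le_inv_eps (ε : Eps) : (1 : ℝ) ≤ (ε : ℝ)⁻¹ := (one_le_inv₀ ε.2.1).2 ε.2.2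

lemma le_inv_eps_pow_of_le {ε : Eps} {C D : ℝ} {a b : ℕ} (hCD : C ≤ D) (hD : 0 ≤ D)
    (h : a ≤ b) : C * (ε : ℝ)⁻¹ ^ a ≤ D * (ε : ℝ)⁻¹ ^ b :=
  (mul_le_mul_of_nonneg_right hCD (pow_nonneg (inv_nonneg.2 ε.2.1.le) _)).trans
    (mul_le_mul_of_nonneg_left (pow_inv_le_pow_inv h) hD)

section SlowOn

variable {ι : Type*} {L : Filter ι} {e : ι → Eps} {s s' : ι → ℝ}

lemma SlowOn.const (c : ℝ) : SlowOn L e fun _ => c := fun t =>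
  ⟨|c| ^ t, Eventually.of_forall fun i =>
    le_mul_of_one_le_right (by positivity) (one_le_inv_eps _)⟩

lemma SlowOn.mono (h : SlowOn L e s) (hs : ∀ᶠ i in L, |s' i| ≤ |s i|) : SlowOn L e s' := by
  intro t
  obtain ⟨C, hC⟩ := h t
  exact ⟨C, by filter_upwards [hC, hs] with i h1 h2
               exact (pow_le_pow_left₀ (abs_nonneg _) h2 t).trans h1⟩

lemma SlowOn.abs (h : SlowOn L e s) : SlowOn L e fun i => |s i| :=
  h.mono (Eventually.of_forall fun i => by simp)

lemma SlowOn.add (h : SlowOn L e s) (h' : SlowOn L e s') : SlowOn L e fun i => s i + s' i := by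
  intro t
  obtain ⟨C, hC⟩ := h t
  obtain ⟨D, hD⟩ := h' t
  refine ⟨2 ^ (t - 1) * (C + D), ?_⟩
  filter_upwards [hC, hD] with i h1 h2
  calc |s i + s' i| ^ t ≤ (|s i| + |s' i|) ^ t :=
        pow_le_pow_left₀ (abs_nonneg _) (abs_add_le _ _) t
    _ ≤ 2 ^ (t - 1) * (|s i| ^ t + |s' i| ^ t) := add_pow_le (abs_nonneg _) (abs_nonneg _) t
    _ ≤ 2 ^ (t - 1) * (C * (e i : ℝ)⁻¹ + D * (e i : ℝ)⁻¹) := by gcongr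
    _ = _ := by ring

lemma SlowOn.mul (h : SlowOn L e s) (h' : SlowOn L e s') : SlowOn L e fun i => s i * s' i := by
  intro t
  obtain ⟨C, hC⟩ := h (2 * t)
  obtain ⟨D, hD⟩ := h' (2 * t)
  refine ⟨C + D, ?_⟩
  filter_upwards [hC, hD] with i h1 h2
  rw [abs_mul, mul_pow, add_mul]
  rw [mul_comm 2 t, pow_mul] at h1 h2
  nlinarith [two_mul_le_add_sq (|s i| ^ t) (|s' i| ^ t), pow_nonneg (abs_nonneg (s i)) t,
    pow_nonneg (abs_nonneg (s' i)) t]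

lemma SlowOn.pow (h : SlowOn L e s) (k : ℕ) : SlowOn L e fun i => s i ^ k := by
  induction k with
  | zero => simpa using SlowOn.const 1
  | succ k ih => simpa [pow_succ] using ih.mul h

lemma SlowOn.sum {κ : Type*} (T : Finset κ) {s : κ → ι → ℝ} (h : ∀ k ∈ T, SlowOn L e (s k)) :
    SlowOn L e fun i => ∑ k ∈ T, s k i := by
  classical
  induction T using Finset.induction_on with
  | empty => simpa using SlowOn.const 0
  | insert a T ha ih =>
    simp only [Finset.sum_insert ha]
    exact (h a (by simp)).add (ih fun k hk => h k (by simp [hk]))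

lemma SlowOn.eventually_le (h : SlowOn L e s) : ∃ C : ℝ, 0 ≤ C ∧ ∀ᶠ i in L, |s i| ≤ C * (e i : ℝ)⁻¹ := by
  obtain ⟨C, hC⟩ := h 1
  refine ⟨|C|, abs_nonneg _, ?_⟩
  filter_upwards [hC] with i hi
  rw [pow_one] at hi
  exact hi.trans (mul_le_mul_of_nonneg_right (le_abs_self C) (inv_nonneg.2 (e i).2.1.le))

lemma SlowOn.comap {κ : Type*} {M : Filter κ} {p : κ → ι} (h : SlowOn L e s) (hp : Tendsto p M L) :
    SlowOn M (e ∘ p) (s ∘ p) := fun t =>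
  let ⟨C, hC⟩ := h t
  ⟨C, hp.eventually hC⟩

end SlowOn

lemma eventually_toZero_le (ε' : Eps) : ∀ᶠ ε in toZero, ε ≤ ε' := by
  have : ∀ᶠ x in 𝓝 (0 : ℝ), x < (ε' : ℝ) := gt_mem_nhds ε'.2.1
  filter_upwards [(this.comap (fun ε : Eps => (ε : ℝ)) : ∀ᶠ ε : Eps in toZero, (ε : ℝ) < ε')] with ε h
  exact Subtype.coe_le_coe.1 h.le

lemma SlowScaled.slowOn {s : Eps → ℝ} (h : SlowScaled s) : SlowOn toZero id s := by
  obtain ⟨ε', h⟩ := h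
  intro t
  obtain ⟨C, -, hC⟩ := h t (Nat.cast_nonneg t)
  refine ⟨C, ?_⟩
  filter_upwards [eventually_toZero_le ε'] with ε hε
  simpa using hC ε hε

/-! ### Families with slowly growing derivatives -/

section SlowBdd

variable {ι : Type*} {L : Filter ι} {e : ι → Eps}
variable {E : Type*} [NormedAddCommGroup E] [NormedSpace ℝ E]
variable {F : Type*} [NormedAddCommGroup F] [NormedSpace ℝ F]
variable {G : Type*} [NormedAddCommGroup G] [NormedSpace ℝ G]
variable {X : Set E}

/-- The family `a` is smooth on `X`, and its derivatives up to the order `J` are bounded on `X`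
by slowly growing families of numbers. -/
structure SlowBdd (L : Filter ι) (e : ι → Eps) (X : Set E) (J : ℕ) (a : ι → E → F) : Prop where
  smooth : ∀ᶠ i in L, ContDiffOn ℝ ∞ (a i) X
  bound : ∀ j ≤ J, ∃ s, SlowOn L e s ∧ ∀ᶠ i in L, ∀ x ∈ X, ‖iteratedFDeriv ℝ j (a i) x‖ ≤ s i

lemma SlowBdd.mono_order {J J' : ℕ} {a : ι → E → F} (h : SlowBdd L e X J a) (hJ : J' ≤ J) :
    SlowBdd L e X J' a :=
  ⟨h.smooth, fun j hj => h.bound j (hj.trans hJ)⟩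

lemma SlowBdd.congr (hX : IsOpen X) {J : ℕ} {a b : ι → E → F} (h : SlowBdd L e X J a)
    (hab : ∀ᶠ i in L, EqOn (b i) (a i) X) : SlowBdd L e X J b := by
  refine ⟨?_, fun j hj => ?_⟩
  · filter_upwards [h.smooth, hab] with i h1 h2
    exact h1.congr h2
  · obtain ⟨s, hs, hb⟩ := h.bound j hj
    refine ⟨s, hs, ?_⟩
    filter_upwards [hb, hab] with i h1 h2 x hx
    have : b i =ᶠ[𝓝 x] a i := Filter.eventuallyEq_of_mem (hX.mem_nhds hx) h2
    rw [(this.iteratedFDeriv ℝ j).eq_of_nhds]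
    exact h1 x hx

lemma SlowBdd.zero_order {J : ℕ} {a : ι → E → F} (h : SlowBdd L e X J a) :
    ∃ s, SlowOn L e s ∧ ∀ᶠ i in L, ∀ x ∈ X, ‖a i x‖ ≤ s i := by
  simpa using h.bound 0 (Nat.zero_le _)

lemma SlowBdd.fderiv (hX : IsOpen X) {J : ℕ} {a : ι → E → F} (h : SlowBdd L e X (J + 1) a) :
    SlowBdd L e X J fun i => fderiv ℝ (a i) := by
  refine ⟨?_, fun j hj => ?_⟩
  · filter_upwards [h.smooth] with i hi
    exact hi.fderiv_of_isOpen hX (by simp)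
  · simpa only [norm_iteratedFDeriv_fderiv] using h.bound (j + 1) (by omega)

lemma SlowBdd.of_fderiv {J : ℕ} {a : ι → E → F} (hs : ∀ᶠ i in L, ContDiffOn ℝ ∞ (a i) X)
    (h0 : ∃ s, SlowOn L e s ∧ ∀ᶠ i in L, ∀ x ∈ X, ‖a i x‖ ≤ s i)
    (h : SlowBdd L e X J fun i => _root_.fderiv ℝ (a i)) : SlowBdd L e X (J + 1) a := by
  refine ⟨hs, fun j hj => ?_⟩
  rcases j with _ | j
  · simpa using h0
  · simpa only [norm_iteratedFDeriv_fderiv] using h.bound j (by omega)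

lemma SlowBdd.add (hX : IsOpen X) {J : ℕ} {a b : ι → E → F} (ha : SlowBdd L e X J a)
    (hb : SlowBdd L e X J b) : SlowBdd L e X J fun i x => a i x + b i x := by
  refine ⟨?_, fun j hj => ?_⟩
  · filter_upwards [ha.smooth, hb.smooth] with i h1 h2
    exact h1.add h2
  · obtain ⟨s, hs, h1⟩ := ha.bound j hj
    obtain ⟨s', hs', h2⟩ := hb.bound j hj
    refine ⟨_, hs.add hs', ?_⟩
    filter_upwards [h1, h2, ha.smooth, hb.smooth] with i h1 h2 h3 h4 x hx
    have hxX := hX.mem_nhds hx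
    have : iteratedFDeriv ℝ j (fun x => a i x + b i x) x = _ :=
      iteratedFDeriv_add_apply ((h3.contDiffAt hxX).of_le (by exact_mod_cast le_top))
        ((h4.contDiffAt hxX).of_le (by exact_mod_cast le_top))
    rw [this]
    exact (norm_add_le _ _).trans (add_le_add (h1 x hx) (h2 x hx))

lemma SlowBdd.const (J : ℕ) {c : ι → F} {s : ι → ℝ} (hs : SlowOn L e s)
    (hc : ∀ᶠ i in L, ‖c i‖ ≤ s i) :
    SlowBdd L e X J fun i _ => c i := by
  refine ⟨Eventually.of_forall fun i => contDiffOn_const, fun j _ => ?_⟩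
  rcases Nat.eq_zero_or_pos j with rfl | hj
  · exact ⟨s, hs, hc.mono fun i h x _ => by simpa using h⟩
  · refine ⟨fun _ => 0, SlowOn.const 0, Eventually.of_forall fun i x _ => ?_⟩
    rw [iteratedFDeriv_const_of_ne hj.ne']
    simp

lemma SlowBdd.sum (hX : IsOpen X) {κ : Type*} (T : Finset κ) {J : ℕ} {a : κ → ι → E → F}
    (h : ∀ k ∈ T, SlowBdd L e X J (a k)) : SlowBdd L e X J fun i x => ∑ k ∈ T, a k i x := by
  classical
  induction T using Finset.induction_on with
  | empty => simpa using SlowBdd.const (X := X) J (c := fun _ => (0 : F)) (SlowOn.const (L := L) (e := e) 0)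
              (by simp)
  | insert k T hk ih =>
    simp only [Finset.sum_insert hk]
    exact (h k (by simp)).add hX (ih fun k hk => h k (by simp [hk]))

lemma SlowBdd.clm_comp (hX : IsOpen X) {J : ℕ} {a : ι → E → F} (ha : SlowBdd L e X J a)
    {ℓ : ι → F →L[ℝ] G} {s : ι → ℝ} (hs : SlowOn L e s) (hℓ : ∀ᶠ i in L, ‖ℓ i‖ ≤ s i) :
    SlowBdd L e X J fun i x => ℓ i (a i x) := by
  refine ⟨?_, fun j hj => ?_⟩
  · filter_upwards [ha.smooth] with i h1
    exact (ℓ i).contDiff.comp_contDiffOn h1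
  · obtain ⟨s', hs', h1⟩ := ha.bound j hj
    refine ⟨_, hs.mul hs', ?_⟩
    filter_upwards [h1, hℓ, ha.smooth] with i h1 h2 h3 x hx
    refine ((ℓ i).norm_iteratedFDeriv_comp_left (h3.contDiffAt (hX.mem_nhds hx))
      (by exact_mod_cast le_top)).trans ?_
    exact mul_le_mul h2 (h1 x hx) (norm_nonneg _) ((norm_nonneg _).trans h2)

lemma SlowBdd.smul (hX : IsOpen X) {J : ℕ} {a : ι → E → ℝ} {b : ι → E → F}
    (ha : SlowBdd L e X J a) (hb : SlowBdd L e X J b) :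
    SlowBdd L e X J fun i x => a i x • b i x := by
  refine ⟨?_, fun j hj => ?_⟩
  · filter_upwards [ha.smooth, hb.smooth] with i h1 h2
    exact h1.smul h2
  · choose! s hs h1 using ha.bound
    choose! s' hs' h2 using hb.bound
    refine ⟨fun i => ∑ l ∈ Finset.range (j + 1), (j.choose l : ℝ) * s l i * s' (j - l) i,
      SlowOn.sum _ fun l hl => ?_, ?_⟩
    · have := Finset.mem_range.1 hl
      exact ((SlowOn.const _).mul (hs l (by omega))).mul (hs' (j - l) (by omega))
    have h1' : ∀ᶠ i in L, ∀ l ∈ Finset.range (j + 1), ∀ x ∈ X,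
        ‖iteratedFDeriv ℝ l (a i) x‖ ≤ s l i :=
      (Finset.eventually_all _).2 fun l hl => h1 l (by have := Finset.mem_range.1 hl; omega)
    have h2' : ∀ᶠ i in L, ∀ l ∈ Finset.range (j + 1), ∀ x ∈ X,
        ‖iteratedFDeriv ℝ l (b i) x‖ ≤ s' l i :=
      (Finset.eventually_all _).2 fun l hl => h2 l (by have := Finset.mem_range.1 hl; omega)
    filter_upwards [h1', h2', ha.smooth, hb.smooth] with i h1 h2 h3 h4 x hx
    have hb := norm_iteratedFDerivWithin_smul_le (𝕜 := ℝ) (N := (∞ : WithTop ℕ∞))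
      h3 h4 (hX.uniqueDiffOn (𝕜 := ℝ)) hx (n := j) (by exact_mod_cast le_top)
    simp only [iteratedFDerivWithin_of_isOpen _ hX hx] at hb
    refine hb.trans (Finset.sum_le_sum fun l hl => ?_)
    have e1 := h1 l hl x hx
    have e2 := h2 (j - l) (Finset.mem_range.2 (by omega)) x hx
    exact mul_le_mul (mul_le_mul_of_nonneg_left e1 (Nat.cast_nonneg _)) e2 (norm_nonneg _)
      (mul_nonneg (Nat.cast_nonneg _) ((norm_nonneg _).trans e1))

/-- Reciprocals of families that are bounded away from zero by the reciprocal of a slowly growing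
family: the derivatives are handled with `D(1/q) = -(1/q)² Dq`, by induction on the order. -/
lemma SlowBdd.inv (hX : IsOpen X) {J : ℕ} {q : ι → E → ℝ} (hq : SlowBdd L e X J q)
    {s : ι → ℝ} (hs : SlowOn L e s) (hsq : ∀ᶠ i in L, ∀ x ∈ X, 0 < q i x ∧ 1 ≤ s i * q i x) :
    SlowBdd L e X J fun i x => (q i x)⁻¹ := by
  have hsm : ∀ᶠ i in L, ContDiffOn ℝ ∞ (fun x => (q i x)⁻¹) X := by
    filter_upwards [hq.smooth, hsq] with i h1 h2
    exact h1.inv fun x hx => (h2 x hx).1.ne'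
  have h0 : ∃ s, SlowOn L e s ∧ ∀ᶠ i in L, ∀ x ∈ X, ‖(q i x)⁻¹‖ ≤ s i := by
    refine ⟨s, hs, ?_⟩
    filter_upwards [hsq] with i h x hx
    obtain ⟨h1, h2⟩ := h x hx
    rw [norm_inv, Real.norm_of_nonneg h1.le, inv_le_iff_one_le_mul₀ h1]
    exact h2
  induction J with
  | zero =>
    refine ⟨hsm, fun j hj => ?_⟩
    obtain rfl : j = 0 := by omega
    simpa using h0
  | succ J ih =>
    refine SlowBdd.of_fderiv hsm h0 ?_
    have hi := ih (hq.mono_order (Nat.le_succ J))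
    have hd := hq.fderiv hX
    have := (hi.smul hX (hi.smul hX hd)).clm_comp hX (ℓ := fun _ => -ContinuousLinearMap.id ℝ _)
      (SlowOn.const 1) (Eventually.of_forall fun i => by
        rw [norm_neg]; exact ContinuousLinearMap.norm_id_le)
    refine this.congr hX ?_
    filter_upwards [hq.smooth, hsq] with i h1 h2 x hx
    have hdx : DifferentiableAt ℝ (q i) x :=
      (h1.contDiffAt (hX.mem_nhds hx)).differentiableAt (by simp)
    have := ((hasFDerivAt_inv (h2 x hx).1.ne').comp x hdx.hasFDerivAt).fderiv
    simp only [_root_.neg_apply, ContinuousLinearMap.id_apply]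
    refine this.trans ?_
    ext v
    simp
    field_simp

end SlowBdd

/-! ### Non-stationary phase -/

lemma eventuallyEq_zero_of_notMem {E F : Type*} [TopologicalSpace E] [Zero F] {K : Set E}
    (hK : IsClosed K) {g : E → F} (hg : ∀ x ∉ K, g x = 0) {x : E}
    (hx : x ∉ K) : g =ᶠ[𝓝 x] fun _ => 0 :=
  Filter.eventuallyEq_of_mem (hK.isOpen_compl.mem_nhds hx) hg

lemma continuous_of_zero_off {E F : Type*} [TopologicalSpace E] [TopologicalSpace F]
    [Zero F] {X K : Set E} (hX : IsOpen X) (hK : IsClosed K) (hKX : K ⊆ X) {g : E → F}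
    (h : ContinuousOn g X) (hg : ∀ x ∉ K, g x = 0) : Continuous g := by
  refine continuous_iff_continuousAt.2 fun x => ?_
  by_cases hx : x ∈ K
  · exact h.continuousAt (hX.mem_nhds (hKX hx))
  · exact continuousAt_const.congr (eventuallyEq_zero_of_notMem hK hg hx).symm

lemma integrable_of_zero_off {E F : Type*} [NormedAddCommGroup E] [NormedAddCommGroup F]
    {X K : Set E} [MeasurableSpace E] [BorelSpace E] {μ : Measure E}
    [IsFiniteMeasureOnCompacts μ] (hX : IsOpen X) (hK : IsCompact K)
    (hKX : K ⊆ X) {g : E → F}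
    (h : ContinuousOn g X) (hg : ∀ x ∉ K, g x = 0) : Integrable g μ :=
  (continuous_of_zero_off hX hK.isClosed hKX h hg).integrable_of_hasCompactSupport
    (HasCompactSupport.intro hK hg)

section Support

variable {E : Type*} [NormedAddCommGroup E] [NormedSpace ℝ E]
variable {F : Type*} [NormedAddCommGroup F] [NormedSpace ℝ F]
variable {X K : Set E}

lemma contDiff_of_zero_off (hX : IsOpen X) (hK : IsClosed K) (hKX : K ⊆ X) {g : E → F}
    (h : ContDiffOn ℝ ∞ g X) (hg : ∀ x ∉ K, g x = 0) : ContDiff ℝ ∞ g := by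
  refine contDiff_iff_contDiffAt.2 fun x => ?_
  by_cases hx : x ∈ K
  · exact h.contDiffAt (hX.mem_nhds (hKX hx))
  · exact contDiffAt_const.congr_of_eventuallyEq (eventuallyEq_zero_of_notMem hK hg hx)

lemma fderiv_zero_off (hK : IsClosed K) {g : E → F} (hg : ∀ x ∉ K, g x = 0) :
    ∀ x ∉ K, fderiv ℝ g x = 0 := fun x hx => by
  rw [(eventuallyEq_zero_of_notMem hK hg hx).fderiv_eq]
  simp

end Support

/-- The oscillating factor `e^{iλθ}` with real phase `θ` and frequency `λ`. -/
noncomputable def osc {E : Type*} (θ : E → ℝ) (l : ℝ) (x : E) : ℂ :=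
  Complex.exp (Complex.I * ((l * θ x : ℝ) : ℂ))

lemma norm_osc {E : Type*} (θ : E → ℝ) (l : ℝ) (x : E) : ‖osc θ l x‖ = 1 := by
  rw [osc, mul_comm, Complex.norm_exp_ofReal_mul_I]

section Osc

variable {n : ℕ} {X K : Set (EucSp n)}

lemma contDiffOn_osc {θ : EucSp n → ℝ} (hθ : ContDiffOn ℝ ∞ θ X) (l : ℝ) :
    ContDiffOn ℝ ∞ (osc θ l) X :=
  Complex.contDiff_exp.comp_contDiffOn
    (contDiffOn_const.mul (Complex.ofRealCLM.contDiff.comp_contDiffOn (contDiffOn_const.mul hθ)))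

lemma fderiv_osc {θ : EucSp n → ℝ} {x : EucSp n} (hθ : DifferentiableAt ℝ θ x) (l : ℝ)
    (v : EucSp n) :
    fderiv ℝ (osc θ l) x v = Complex.I * l * (fderiv ℝ θ x v : ℝ) * osc θ l x := by
  have h1 : HasFDerivAt (fun x => ((l * θ x : ℝ) : ℂ))
      (Complex.ofRealCLM.comp (l • fderiv ℝ θ x)) x :=
    Complex.ofRealCLM.hasFDerivAt.comp x (hθ.hasFDerivAt.const_mul l)
  have h2 := (h1.const_mul Complex.I).cexp
  have h3 : fderiv ℝ (osc θ l) x = _ := h2.fderiv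
  rw [h3]
  simp [osc]
  ring

/-- One integration by parts along a vector field `a` with `⟨a, ∇θ⟩ = 1` on `X`, for an amplitude
with compact support in `X`. -/
lemma integral_mul_osc (hX : IsOpen X) (hK : IsCompact K) (hKX : K ⊆ X) {θ : EucSp n → ℝ}
    (hθ : ContDiffOn ℝ ∞ θ X) {A : EucSp n → ℂ} {a : Fin n → EucSp n → ℝ}
    (hA : ContDiffOn ℝ ∞ A X) (ha : ∀ j, ContDiffOn ℝ ∞ (a j) X) (hAK : ∀ x ∉ K, A x = 0)
    (haθ : ∀ x ∈ X, ∑ j, a j x * fderiv ℝ θ x (EuclideanSpace.single j 1) = 1) (l : ℝ) :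
    l * ∫ x, A x * osc θ l x =
      Complex.I * ∫ x, (∑ j, fderiv ℝ (fun x => a j x • A x) x (EuclideanSpace.single j 1)) *
        osc θ l x := by
  have hB : ∀ j, ContDiffOn ℝ ∞ (fun x => a j x • A x) X := fun j => (ha j).smul hA
  have hBK : ∀ j, ∀ x ∉ K, a j x • A x = 0 := fun j x hx => by rw [hAK x hx, smul_zero]
  have hBs : ∀ j, ContDiff ℝ ∞ (fun x => a j x • A x) := fun j =>
    contDiff_of_zero_off hX hK.isClosed hKX (hB j) (hBK j)
  have hO := contDiffOn_osc hθ l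
  have hts : ∀ j, tsupport (fun x => a j x • A x) ⊆ K := fun j =>
    closure_minimal (fun x hx => by_contra fun hxK => hx (hBK j x hxK)) hK.isClosed
  have hi1 : ∀ j, Integrable (fun x =>
      fderiv ℝ (fun x => a j x • A x) x (EuclideanSpace.single j 1) * osc θ l x) := fun j => by
    refine integrable_of_zero_off hX hK hKX ?_ fun x hx => ?_
    · exact ((((hBs j).continuous_fderiv (by simp)).clm_apply continuous_const).continuousOn).mul
        hO.continuousOn
    · rw [fderiv_zero_off hK.isClosed (hBK j) x hx]; simp
  have hdO : ∀ v, ContinuousOn (fun x => fderiv ℝ (osc θ l) x v) X := fun v =>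
    (hO.continuousOn_fderiv_of_isOpen hX (by simp)).clm_apply continuousOn_const
  have hi2 : ∀ j, Integrable (fun x =>
      (a j x • A x) * fderiv ℝ (osc θ l) x (EuclideanSpace.single j 1)) := fun j =>
    integrable_of_zero_off hX hK hKX ((hB j).continuousOn.mul (hdO _))
      fun x hx => by rw [hBK j x hx, zero_mul]
  have key : ∀ j, ∫ x, (a j x • A x) * fderiv ℝ (osc θ l) x (EuclideanSpace.single j 1) =
      -∫ x, fderiv ℝ (fun x => a j x • A x) x (EuclideanSpace.single j 1) * osc θ l x := fun j =>
    integral_mul_fderiv_eq_neg_fderiv_mul_of_integrable (hi1 j) (hi2 j)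
      (integrable_of_zero_off hX hK hKX ((hB j).continuousOn.mul hO.continuousOn)
        fun x hx => by rw [hBK j x hx, zero_mul])
      (fun x _ => (hBs j).differentiable (by simp) x)
      (fun x hx => (hO.contDiffAt (hX.mem_nhds (hKX (hts j hx)))).differentiableAt (by simp))
  have e1 : ∀ x, Complex.I * l * (A x * osc θ l x) =
      ∑ j, (a j x • A x) * fderiv ℝ (osc θ l) x (EuclideanSpace.single j 1) := fun x => by
    by_cases hx : x ∈ X
    · have hd : DifferentiableAt ℝ θ x :=
        (hθ.contDiffAt (hX.mem_nhds hx)).differentiableAt (by simp)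
      have : (∑ j, ((a j x : ℝ) : ℂ) * (fderiv ℝ θ x (EuclideanSpace.single j 1) : ℝ)) = 1 := by
        exact_mod_cast congrArg (fun r : ℝ => (r : ℂ)) (haθ x hx)
      calc _ = Complex.I * l * (A x * osc θ l x) *
            ∑ j, ((a j x : ℝ) : ℂ) * (fderiv ℝ θ x (EuclideanSpace.single j 1) : ℝ) := by
              rw [this, mul_one]
        _ = _ := by
          rw [Finset.mul_sum]
          refine Finset.sum_congr rfl fun j _ => ?_
          rw [fderiv_osc hd, Complex.real_smul]
          ring
    · have : A x = 0 := hAK x fun h => hx (hKX h)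
      simp [this]
  have e2 : Complex.I * l * ∫ x, A x * osc θ l x =
      -∫ x, (∑ j, fderiv ℝ (fun x => a j x • A x) x (EuclideanSpace.single j 1)) *
        osc θ l x := by
    rw [← integral_const_mul]
    simp_rw [e1, Finset.sum_mul]
    rw [integral_finsetSum _ fun j _ => hi2 j,
      integral_finsetSum _ fun j _ => hi1 j, ← Finset.sum_neg_distrib]
    exact Finset.sum_congr rfl fun j _ => key j
  linear_combination (-Complex.I) * e2 + (l * ∫ x, A x * osc θ l x) * Complex.I_sq

/-- Repeated integration by parts along `∇θ/|∇θ|²`: an oscillatory integral whose phase has a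
gradient bounded away from zero decays like `λ⁻ᵏ`, with a slowly growing constant. -/
theorem nonstationary_phase {ι : Type*} {L : Filter ι} {e : ι → Eps} (hX : IsOpen X)
    (hK : IsCompact K) (hKX : K ⊆ X) {θ : ι → EucSp n → ℝ}
    (hθ : ∀ᶠ i in L, ContDiffOn ℝ ∞ (θ i) X)
    (hdθ : ∀ J, SlowBdd L e X J fun i => fderiv ℝ (θ i))
    {s : ι → ℝ} (hs : SlowOn L e s)
    (hsθ : ∀ᶠ i in L, ∀ x ∈ X,
      1 ≤ s i * ∑ j, fderiv ℝ (θ i) x (EuclideanSpace.single j 1) ^ 2)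
    (k : ℕ) {A : ι → EucSp n → ℂ} (hA : SlowBdd L e X k A)
    (hAK : ∀ᶠ i in L, ∀ x ∉ K, A i x = 0) :
    ∃ S, SlowOn L e S ∧ ∀ᶠ i in L, ∀ l : ℝ, 0 < l →
      l ^ k * ‖∫ x, A i x * osc (θ i) l x‖ ≤ S i := by
  have hd : ∀ J (j : Fin n), SlowBdd L e X J fun i x =>
      fderiv ℝ (θ i) x (EuclideanSpace.single j 1) := fun J j =>
    (hdθ J).clm_comp hX
      (ℓ := fun _ => ContinuousLinearMap.apply ℝ ℝ (EuclideanSpace.single j (1 : ℝ)))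
      (SlowOn.const _) (Eventually.of_forall fun i => le_rfl)
  have hq : ∀ J, SlowBdd L e X J fun i x =>
      ∑ j, fderiv ℝ (θ i) x (EuclideanSpace.single j 1) ^ 2 := fun J => by
    simp only [pow_two]
    exact SlowBdd.sum hX _ fun j _ => (hd J j).smul hX (hd J j)
  have hqi : ∀ J, SlowBdd L e X J fun i x =>
      (∑ j, fderiv ℝ (θ i) x (EuclideanSpace.single j 1) ^ 2)⁻¹ := fun J => by
    refine (hq J).inv hX hs ?_
    filter_upwards [hsθ] with i hi x hx
    have h0 : 0 ≤ ∑ j, fderiv ℝ (θ i) x (EuclideanSpace.single j 1) ^ 2 :=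
      Finset.sum_nonneg fun j _ => sq_nonneg _
    refine ⟨h0.lt_of_ne fun h => ?_, hi x hx⟩
    have := hi x hx
    rw [← h, mul_zero] at this
    linarith
  have ha : ∀ J j, SlowBdd L e X J fun i x =>
      (∑ j, fderiv ℝ (θ i) x (EuclideanSpace.single j 1) ^ 2)⁻¹ •
        fderiv ℝ (θ i) x (EuclideanSpace.single j 1) := fun J j =>
    (hqi J).smul hX (hd J j)
  induction k generalizing A with
  | zero =>
    obtain ⟨S, hS, h⟩ := hA.zero_order
    refine ⟨fun i => S i * (volume : Measure (EucSp n)).real K,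
      hS.mul (SlowOn.const _), ?_⟩
    filter_upwards [h, hAK] with i h1 h2 l _
    rw [pow_zero, one_mul, ← setIntegral_eq_integral_of_forall_compl_eq_zero
      (s := K) fun x hx => by rw [h2 x hx, zero_mul]]
    refine norm_setIntegral_le_of_norm_le_const hK.measure_lt_top fun x hx => ?_
    rw [norm_mul, norm_osc, mul_one]
    exact h1 x (hKX hx)
  | succ k ih =>
    have hA' : SlowBdd L e X k fun i x => ∑ j, fderiv ℝ (fun x =>
        ((∑ j, fderiv ℝ (θ i) x (EuclideanSpace.single j 1) ^ 2)⁻¹ •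
          fderiv ℝ (θ i) x (EuclideanSpace.single j 1)) • A i x) x (EuclideanSpace.single j 1) :=
      SlowBdd.sum hX _ fun j _ => (((ha (k + 1) j).smul hX hA).fderiv hX).clm_comp hX
        (ℓ := fun _ => ContinuousLinearMap.apply ℝ ℂ (EuclideanSpace.single j (1 : ℝ)))
        (SlowOn.const _) (Eventually.of_forall fun i => le_rfl)
    obtain ⟨S, hS, h⟩ := ih hA' (by
      filter_upwards [hAK] with i hi x hx
      refine Finset.sum_eq_zero fun j _ => ?_
      rw [fderiv_zero_off hK.isClosed (fun x hx => by rw [hi x hx, smul_zero]) x hx]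
      rfl)
    refine ⟨S, hS, ?_⟩
    have has : ∀ᶠ i in L, ∀ j ∈ (Finset.univ : Finset (Fin n)), ContDiffOn ℝ ∞ (fun x =>
        (∑ j, fderiv ℝ (θ i) x (EuclideanSpace.single j 1) ^ 2)⁻¹ •
          fderiv ℝ (θ i) x (EuclideanSpace.single j 1)) X :=
      (Finset.eventually_all _).2 fun j _ => (ha 0 j).smooth
    filter_upwards [h, hθ, hA.smooth, has, hAK, hsθ] with i h h1 h2 h3 h4 h5 l hl
    have := integral_mul_osc hX hK hKX h1 h2 (fun j => h3 j (Finset.mem_univ j)) h4 (fun x hx => by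
      have h0 : (∑ j, fderiv ℝ (θ i) x (EuclideanSpace.single j 1) ^ 2) ≠ 0 := fun h => by
        have := h5 x hx
        rw [h, mul_zero] at this
        linarith
      simp only [smul_eq_mul, mul_assoc, ← pow_two, ← Finset.mul_sum]
      exact inv_mul_cancel₀ h0) l
    have hn := congrArg norm this
    rw [norm_mul, norm_mul, Complex.norm_I, one_mul, Complex.norm_real,
      Real.norm_of_nonneg hl.le] at hn
    rw [pow_succ, mul_assoc, hn]
    exact h l hl

end Osc

/-! ### Fourier transforms of compactly supported nets -/

section Fourier

variable {n : ℕ}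

/-- Moderate nets of smooth functions on `ℝⁿ` with supports in a common compact set. -/
structure ModCpt (w : Eps → EucSp n → ℂ) : Prop where
  smooth : ∀ ε, ContDiff ℝ ∞ (w ε)
  supp : ∃ K, IsCompact K ∧ ∀ ε, ∀ x ∉ K, w ε x = 0
  bound : ∀ k : ℕ, ∃ (N : ℕ) (C : ℝ), ∀ᶠ ε in toZero, ∀ x,
    ‖iteratedFDeriv ℝ k (w ε) x‖ ≤ C * (ε : ℝ)⁻¹ ^ N

lemma iteratedFDeriv_zero_off {E F : Type*} [NormedAddCommGroup E] [NormedSpace ℝ E]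
    [NormedAddCommGroup F] [NormedSpace ℝ F] {K : Set E} (hK : IsClosed K) {g : E → F}
    (hg : ∀ x ∉ K, g x = 0) (k : ℕ) : ∀ x ∉ K, iteratedFDeriv ℝ k g x = 0 := fun x hx => by
  rw [((eventuallyEq_zero_of_notMem hK hg hx).iteratedFDeriv ℝ k).eq_of_nhds]
  simp

lemma ModCpt.of_isModerate {Ω : Set (EucSp n)} (hΩ : IsOpen Ω) {w : Eps → EucSp n → ℂ}
    (hw : IsModerate Ω w) {K : Set (EucSp n)} (hK : IsCompact K) (hKΩ : K ⊆ Ω)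
    (h0 : ∀ ε, ∀ x ∉ K, w ε x = 0) : ModCpt w := by
  refine ⟨fun ε => contDiff_of_zero_off hΩ hK.isClosed hKΩ (hw.1 ε) (h0 ε), ⟨K, hK, h0⟩,
    fun k => ?_⟩
  obtain ⟨N, C, hC⟩ := hw.2 K hK hKΩ k
  refine ⟨N, |C|, ?_⟩
  filter_upwards [hC] with ε hε x
  by_cases hx : x ∈ K
  · exact (hε x hx).trans (mul_pow_inv_le le_rfl)
  · rw [iteratedFDeriv_zero_off hK.isClosed (h0 ε) k x hx, norm_zero]
    exact mul_nonneg (abs_nonneg _) (pow_nonneg (inv_nonneg.2 ε.2.1.le) _)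

lemma ModCpt.integrable {w : Eps → EucSp n → ℂ} (hw : ModCpt w) (ε : Eps) :
    Integrable (w ε) := by
  obtain ⟨K, hK, h⟩ := hw.supp
  exact (hw.smooth ε).continuous.integrable_of_hasCompactSupport (HasCompactSupport.intro hK (h ε))

lemma fourierOn_univ_smul (w : EucSp n → ℂ) (ξ : EucSp n) :
    fourierOn Set.univ w ((2 * Real.pi) • ξ) = 𝓕 w ξ := by
  rw [fourierOn, setIntegral_univ, Real.fourier_eq']
  refine integral_congr_ae (Eventually.of_forall fun x => ?_)
  simp only [inner_smul_right, smul_eq_mul]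
  rw [mul_comm]
  congr 2
  push_cast
  ring

lemma fourierOn_eq_univ {Ω : Set (EucSp n)} {w : EucSp n → ℂ} (hw : ∀ x ∉ Ω, w x = 0) :
    fourierOn Ω w = fourierOn Set.univ w := by
  ext ξ
  rw [fourierOn, fourierOn, setIntegral_univ]
  exact setIntegral_eq_integral_of_forall_compl_eq_zero fun x hx => by rw [hw x hx, zero_mul]

lemma norm_fourier_le_of_bound {w : EucSp n → ℂ} {K : Set (EucSp n)} (hK : IsCompact K)
    (h0 : ∀ x ∉ K, w x = 0) {C : ℝ} (hC : ∀ x, ‖w x‖ ≤ C) (ξ : EucSp n) :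
    ‖𝓕 w ξ‖ ≤ C * (volume : Measure (EucSp n)).real K := by
  rw [Real.fourier_eq', ← setIntegral_eq_integral_of_forall_compl_eq_zero (s := K)
    fun x hx => by rw [h0 x hx, smul_zero]]
  refine norm_setIntegral_le_of_norm_le_const hK.measure_lt_top fun x _ => ?_
  rw [norm_smul, Complex.norm_exp_ofReal_mul_I, one_mul]
  exact hC x

lemma ModCpt.pow_mul_norm_fourier_le {w : Eps → EucSp n → ℂ} (hw : ModCpt w) (p : ℕ) :
    ∃ (N : ℕ) (C : ℝ), 0 ≤ C ∧ ∀ᶠ ε in toZero, ∀ ξ, ‖ξ‖ ^ p * ‖𝓕 (w ε) ξ‖ ≤ C * (ε : ℝ)⁻¹ ^ N := by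
  obtain ⟨K, hK, h0⟩ := hw.supp
  choose N C hC using hw.bound
  set V := (volume : Measure (EucSp n)).real K
  refine ⟨(Finset.range (p + 1)).sup N, 2 ^ p * ∑ j ∈ Finset.range (p + 1), |C j| * V,
    by positivity, ?_⟩
  filter_upwards [(Finset.eventually_all (Finset.range (p + 1))).2 fun j _ => hC j] with ε hε ξ
  have hD : ∀ j, ∀ x ∉ K, ‖iteratedFDeriv ℝ j (w ε) x‖ = 0 := fun j x hx => by
    rw [iteratedFDeriv_zero_off hK.isClosed (h0 ε) j x hx, norm_zero]
  have hc : ∀ j : ℕ, Continuous fun x => ‖iteratedFDeriv ℝ j (w ε) x‖ := fun j =>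
    ((hw.smooth ε).continuous_iteratedFDeriv (by exact_mod_cast le_top)).norm
  have := Real.pow_mul_norm_iteratedFDeriv_fourier_le (K := 0) (N := (⊤ : ℕ∞)) (hw.smooth ε)
    (fun k j _ _ => ((continuous_norm.pow k).mul (hc j)).integrable_of_hasCompactSupport
      (HasCompactSupport.intro hK fun x hx => by simp [hD j x hx])) (k := 0) (n := p)
      le_rfl le_top ξ
  simp only [norm_iteratedFDeriv_zero] at this
  refine this.trans ?_
  rw [Finset.range_one, Finset.sum_product]
  simp only [Finset.sum_singleton, pow_zero, one_mul, CharP.cast_eq_zero, mul_zero, zero_add]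
  rw [mul_assoc, Finset.sum_mul]
  refine mul_le_mul_of_nonneg_left (Finset.sum_le_sum fun j hj => ?_) (by positivity)
  have hb : ‖∫ x, ‖iteratedFDeriv ℝ j (w ε) x‖‖ ≤ C j * (ε : ℝ)⁻¹ ^ N j * V := by
    rw [← setIntegral_eq_integral_of_forall_compl_eq_zero (s := K) (hD j)]
    refine norm_setIntegral_le_of_norm_le_const hK.measure_lt_top fun x _ => ?_
    rw [norm_norm]
    exact hε j hj x
  calc _ ≤ _ := le_abs_self _
    _ ≤ _ := hb
    _ ≤ |C j| * (ε : ℝ)⁻¹ ^ ((Finset.range (p + 1)).sup N) * V :=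
      mul_le_mul_of_nonneg_right (mul_pow_inv_le (Finset.le_sup hj)) measureReal_nonneg
    _ = _ := by ring

/-- The Fourier transform of a moderate net with joint compact support decreases rapidly, with an
order in `ε⁻¹` that may depend on the rate of decrease. -/
lemma ModCpt.fourier_decay {w : Eps → EucSp n → ℂ} (hw : ModCpt w) (p : ℕ) :
    ∃ (N : ℕ) (C : ℝ), 0 ≤ C ∧ ∀ᶠ ε in toZero, ∀ ξ,
      (1 + ‖ξ‖) ^ p * ‖𝓕 (w ε) ξ‖ ≤ C * (ε : ℝ)⁻¹ ^ N := by
  obtain ⟨N, C, hC0, hC⟩ := hw.pow_mul_norm_fourier_le p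
  obtain ⟨M, D, hD0, hD⟩ := hw.pow_mul_norm_fourier_le 0
  refine ⟨max N M, 2 ^ (p - 1) * (D + C), by positivity, ?_⟩
  filter_upwards [hC, hD] with ε h1 h2 ξ
  have e1 := (h1 ξ).trans (le_inv_eps_pow_of_le le_rfl hC0 (le_max_left N M))
  have e2 := (h2 ξ).trans (le_inv_eps_pow_of_le le_rfl hD0 (le_max_right N M))
  rw [pow_zero, one_mul] at e2
  calc _ ≤ 2 ^ (p - 1) * (1 ^ p + ‖ξ‖ ^ p) * ‖𝓕 (w ε) ξ‖ :=
        mul_le_mul_of_nonneg_right (add_pow_le zero_le_one (norm_nonneg _) p) (norm_nonneg _)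
    _ = 2 ^ (p - 1) * (‖𝓕 (w ε) ξ‖ + ‖ξ‖ ^ p * ‖𝓕 (w ε) ξ‖) := by rw [one_pow]; ring
    _ ≤ 2 ^ (p - 1) * (D * (ε : ℝ)⁻¹ ^ max N M + C * (ε : ℝ)⁻¹ ^ max N M) := by gcongr
    _ = _ := by ring

/-- Rapid decrease in terms of Mathlib's normalization of the Fourier transform. -/
lemma rapidlyDecreasing_iff {w : Eps → EucSp n → ℂ} {Γ : Set (USphere n)} :
    RapidlyDecreasing (fun ε => fourierOn Set.univ (w ε)) Γ ↔
      ∃ N : ℕ, ∀ p : ℕ, ∃ C : ℝ, 0 ≤ C ∧ ∀ᶠ ε in toZero, ∀ t : ℝ, 0 < t → ∀ ξ ∈ Γ,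
        (1 + t) ^ p * ‖𝓕 (w ε) (t • (ξ : EucSp n))‖ ≤ C * (ε : ℝ)⁻¹ ^ N := by
  have h2π : 0 < 2 * Real.pi := by positivity
  have hpow : ∀ (ε : Eps) (N : ℕ), 0 ≤ (ε : ℝ)⁻¹ ^ N := fun ε N =>
    pow_nonneg (inv_nonneg.2 ε.2.1.le) _
  refine exists_congr fun N => forall_congr' fun p => ⟨?_, ?_⟩
  · rintro ⟨C, hC⟩
    refine ⟨2 ^ p * |C|, by positivity, ?_⟩
    filter_upwards [hC] with ε hε t ht ξ hξ
    have := hε (2 * Real.pi * t) (by positivity) ξ hξ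
    rw [mul_smul, fourierOn_univ_smul, Real.rpow_div_two_eq_sqrt _ (by positivity),
      Real.rpow_natCast] at this
    have h1 : 1 + t ≤ 2 * √(1 + (2 * Real.pi * t) ^ 2) := by
      have : t ≤ 2 * Real.pi * t := le_mul_of_one_le_left ht.le (by linarith [Real.two_le_pi])
      have h3 : 1 ≤ √(1 + (2 * Real.pi * t) ^ 2) := Real.one_le_sqrt.2 (by nlinarith)
      have h4 : 2 * Real.pi * t ≤ √(1 + (2 * Real.pi * t) ^ 2) :=
        Real.le_sqrt_of_sq_le (by linarith)
      linarith
    calc _ ≤ (2 * √(1 + (2 * Real.pi * t) ^ 2)) ^ p * ‖𝓕 (w ε) (t • (ξ : EucSp n))‖ := by gcongr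
      _ ≤ 2 ^ p * (|C| * (ε : ℝ)⁻¹ ^ N) := by
        rw [mul_pow, mul_assoc]
        exact mul_le_mul_of_nonneg_left (this.trans (mul_pow_inv_le le_rfl)) (by positivity)
      _ = _ := by ring
  · rintro ⟨C, hC0, hC⟩
    refine ⟨7 ^ p * C, ?_⟩
    filter_upwards [hC] with ε hε t ht ξ hξ
    have := hε (t / (2 * Real.pi)) (by positivity) ξ hξ
    have e : t • (ξ : EucSp n) = (2 * Real.pi) • ((t / (2 * Real.pi)) • (ξ : EucSp n)) := by
      rw [smul_smul, mul_div_cancel₀ _ h2π.ne']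
    rw [e, fourierOn_univ_smul, Real.rpow_div_two_eq_sqrt _ (by positivity), Real.rpow_natCast]
    have h1 : √(1 + t ^ 2) ≤ 7 * (1 + t / (2 * Real.pi)) := by
      have h2 : t ≤ 7 * (t / (2 * Real.pi)) := by
        rw [← mul_div_assoc, le_div_iff₀ h2π]
        nlinarith [Real.pi_lt_d2]
      have h3 : √(1 + t ^ 2) ≤ 1 + t := Real.sqrt_le_iff.2 ⟨by positivity, by nlinarith⟩
      linarith
    calc _ ≤ (7 * (1 + t / (2 * Real.pi))) ^ p *
            ‖𝓕 (w ε) ((t / (2 * Real.pi)) • (ξ : EucSp n))‖ := by gcongr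
      _ ≤ 7 ^ p * (C * (ε : ℝ)⁻¹ ^ N) := by
        rw [mul_pow, mul_assoc]
        exact mul_le_mul_of_nonneg_left this (by positivity)
      _ = _ := by ring

/-- Negligible nets with joint compact support have rapidly decreasing Fourier transforms. No
estimate of derivatives is needed: the square of the weighted transform is the product of a
negligible factor, the transform itself, and of a moderate one. -/
lemma ModCpt.rapidlyDecreasing_of_negligible {w : Eps → EucSp n → ℂ} (hw : ModCpt w)
    (hn : ∀ q : ℕ, ∃ C : ℝ, ∀ᶠ ε in toZero, ∀ x, ‖w ε x‖ ≤ C * (ε : ℝ) ^ q)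
    (Γ : Set (USphere n)) : RapidlyDecreasing (fun ε => fourierOn Set.univ (w ε)) Γ := by
  refine rapidlyDecreasing_iff.2 ⟨0, fun p => ?_⟩
  obtain ⟨K, hK, h0⟩ := hw.supp
  obtain ⟨N, C, hC0, hC⟩ := hw.fourier_decay (2 * p)
  -- The order `N` of the negligible factor compensates the growth of the moderate one.
  obtain ⟨D, hD⟩ := hn N
  set V := (volume : Measure (EucSp n)).real K
  refine ⟨1 + C * (|D| * V), by positivity, ?_⟩
  filter_upwards [hC, hD] with ε h1 h2 t ht ξ _
  have hε : (0 : ℝ) < ε := ε.2.1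
  have hξ : ‖t • (ξ : EucSp n)‖ = t := by
    rw [norm_smul, Real.norm_of_nonneg ht.le, norm_eq_of_mem_sphere, mul_one]
  have e1 := h1 (t • (ξ : EucSp n))
  rw [hξ] at e1
  have e2 := norm_fourier_le_of_bound hK (h0 ε) (C := |D| * (ε : ℝ) ^ N)
    (fun x => (h2 x).trans (mul_le_mul_of_nonneg_right (le_abs_self D) (by positivity)))
    (t • (ξ : EucSp n))
  rw [pow_zero, mul_one]
  have e3 : ((1 + t) ^ p * ‖𝓕 (w ε) (t • (ξ : EucSp n))‖) ^ 2 ≤ C * (|D| * V) := by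
    calc _ = ((1 + t) ^ (2 * p) * ‖𝓕 (w ε) (t • (ξ : EucSp n))‖) *
            ‖𝓕 (w ε) (t • (ξ : EucSp n))‖ := by ring
      _ ≤ (C * (ε : ℝ)⁻¹ ^ N) * (|D| * (ε : ℝ) ^ N * V) := by gcongr
      _ = C * (|D| * V) * ((ε : ℝ)⁻¹ ^ N * (ε : ℝ) ^ N) := by ring
      _ = _ := by rw [← mul_pow, inv_mul_cancel₀ hε.ne', one_pow, mul_one]
  nlinarith [sq_nonneg ((1 + t) ^ p * ‖𝓕 (w ε) (t • (ξ : EucSp n))‖ - 1)]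

lemma RapidlyDecreasing.add {g h : Eps → EucSp n → ℂ} {Γ : Set (USphere n)}
    (hg : RapidlyDecreasing g Γ) (hh : RapidlyDecreasing h Γ) :
    RapidlyDecreasing (fun ε ξ => g ε ξ + h ε ξ) Γ := by
  obtain ⟨N, hN⟩ := hg
  obtain ⟨M, hM⟩ := hh
  refine ⟨max N M, fun p => ?_⟩
  obtain ⟨C, hC⟩ := hN p
  obtain ⟨D, hD⟩ := hM p
  refine ⟨|C| + |D|, ?_⟩
  filter_upwards [hC, hD] with ε h1 h2 t ht ξ hξ
  have e1 := (h1 t ht ξ hξ).trans (mul_pow_inv_le (le_max_left N M))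
  have e2 := (h2 t ht ξ hξ).trans (mul_pow_inv_le (le_max_right N M))
  rw [add_mul]
  refine le_trans ?_ (add_le_add e1 e2)
  rw [← mul_add]
  exact mul_le_mul_of_nonneg_left (norm_add_le _ _) (by positivity)

lemma RapidlyDecreasing.mono {g : Eps → EucSp n → ℂ} {Γ Γ' : Set (USphere n)}
    (hg : RapidlyDecreasing g Γ) (h : Γ' ⊆ Γ) : RapidlyDecreasing g Γ' := by
  obtain ⟨N, hN⟩ := hg
  refine ⟨N, fun p => ?_⟩
  obtain ⟨C, hC⟩ := hN p
  exact ⟨C, hC.mono fun ε h1 t ht ξ hξ => h1 t ht ξ (h hξ)⟩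

lemma RapidlyDecreasing.union {g : Eps → EucSp n → ℂ} {Γ Γ' : Set (USphere n)}
    (hg : RapidlyDecreasing g Γ) (hg' : RapidlyDecreasing g Γ') :
    RapidlyDecreasing g (Γ ∪ Γ') := by
  obtain ⟨N, hN⟩ := hg
  obtain ⟨M, hM⟩ := hg'
  refine ⟨max N M, fun p => ?_⟩
  obtain ⟨C, hC⟩ := hN p
  obtain ⟨D, hD⟩ := hM p
  refine ⟨max |C| |D|, ?_⟩
  filter_upwards [hC, hD] with ε h1 h2 t ht ξ hξ
  have h0 : (0 : ℝ) ≤ (ε : ℝ)⁻¹ ^ max N M := pow_nonneg (inv_nonneg.2 ε.2.1.le) _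
  rcases hξ with hξ | hξ
  · exact ((h1 t ht ξ hξ).trans (mul_pow_inv_le (le_max_left N M))).trans
      (mul_le_mul_of_nonneg_right (le_max_left _ _) h0)
  · exact ((h2 t ht ξ hξ).trans (mul_pow_inv_le (le_max_right N M))).trans
      (mul_le_mul_of_nonneg_right (le_max_right _ _) h0)

lemma RapidlyDecreasing.congr {g h : Eps → EucSp n → ℂ} {Γ : Set (USphere n)}
    (hg : RapidlyDecreasing g Γ) (hgh : ∀ᶠ ε in toZero, g ε = h ε) : RapidlyDecreasing h Γ := by
  obtain ⟨N, hN⟩ := hg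
  refine ⟨N, fun p => ?_⟩
  obtain ⟨C, hC⟩ := hN p
  refine ⟨C, ?_⟩
  filter_upwards [hC, hgh] with ε h1 h2
  rwa [← h2]

lemma fourierOn_add {v w : EucSp n → ℂ} (hv : Integrable v) (hw : Integrable w) (ξ : EucSp n) :
    fourierOn Set.univ (fun x => v x + w x) ξ =
      fourierOn Set.univ v ξ + fourierOn Set.univ w ξ := by
  have e : ∀ u : EucSp n → ℂ, fourierOn Set.univ u ξ = 𝓕 u ((2 * Real.pi)⁻¹ • ξ) := fun u => by
    rw [← fourierOn_univ_smul, smul_smul, mul_inv_cancel₀ (by positivity), one_smul]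
  rw [e, e, e]
  exact congrFun (VectorFourier.fourierIntegral_add Real.continuous_fourierChar
    (by exact continuous_inner) hv hw) _

end Fourier

/-! ### Composition with a slow scaled map -/

section Pullback

variable {n m : ℕ} {X K : Set (EucSp n)}

lemma SlowBdd.comap {ι κ : Type*} {L : Filter ι} {M : Filter κ} {e : ι → Eps} {p : κ → ι}
    {E F : Type*} [NormedAddCommGroup E] [NormedSpace ℝ E] [NormedAddCommGroup F]
    [NormedSpace ℝ F] {X : Set E} {J : ℕ} {a : ι → E → F} (h : SlowBdd L e X J a)
    (hp : Tendsto p M L) : SlowBdd M (e ∘ p) X J (a ∘ p) :=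
  ⟨hp.eventually h.smooth, fun j hj =>
    let ⟨_, hs, hb⟩ := h.bound j hj
    ⟨_, hs.comap hp, hp.eventually hb⟩⟩

/-- The phase of the oscillatory integrals that arise when a plane wave of frequency `η` is
composed with `h` and tested against one of frequency `ζ`. -/
noncomputable def pullPhase (h : EucSp n → EucSp m) (η : EucSp m) (ζ : EucSp n) (x : EucSp n) : ℝ :=
  2 * Real.pi * (⟪η, h x⟫_ℝ - ⟪ζ, x⟫_ℝ)

lemma pullPhase_hasFDerivAt {h : EucSp n → EucSp m} {x : EucSp n} (hx : DifferentiableAt ℝ h x)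
    (η : EucSp m) (ζ : EucSp n) (c : ℝ) :
    HasFDerivAt (fun x => c * pullPhase h η ζ x)
      ((((c * (2 * Real.pi)) • innerSL ℝ η).comp (fderiv ℝ h x)) -
        (c * (2 * Real.pi)) • innerSL ℝ ζ) x := by
  have h1 : HasFDerivAt (fun x => ⟪η, h x⟫_ℝ) ((innerSL ℝ η).comp (fderiv ℝ h x)) x :=
    (innerSL ℝ η).hasFDerivAt.comp x hx.hasFDerivAt
  have h2 : HasFDerivAt (fun x => ⟪ζ, x⟫_ℝ) (innerSL ℝ ζ) x := (innerSL ℝ ζ).hasFDerivAt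
  refine (((h1.sub h2).const_mul (2 * Real.pi)).const_mul c).congr_fderiv ?_
  ext v
  simp
  ring

lemma sum_fderiv_pullPhase_sq {h : EucSp n → EucSp m} {x : EucSp n} (hx : DifferentiableAt ℝ h x)
    (η : EucSp m) (ζ : EucSp n) (c : ℝ) :
    ∑ j, fderiv ℝ (fun x => c * pullPhase h η ζ x) x (EuclideanSpace.single j 1) ^ 2 =
      (c * (2 * Real.pi)) ^ 2 * ‖transJac h x η - ζ‖ ^ 2 := by
  rw [(pullPhase_hasFDerivAt hx η ζ c).fderiv, EuclideanSpace.norm_sq_eq, Finset.mul_sum]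
  refine Finset.sum_congr rfl fun j _ => ?_
  have e1 : ⟪transJac h x η, EuclideanSpace.single j (1 : ℝ)⟫_ℝ =
      ⟪η, fderiv ℝ h x (EuclideanSpace.single j 1)⟫_ℝ :=
    ContinuousLinearMap.adjoint_inner_left _ _ _
  rw [EuclideanSpace.inner_single_right] at e1
  simp only [one_mul, conj_trivial] at e1
  simp [← e1, EuclideanSpace.inner_single_right]
  ring

/-- Uniform decay of the oscillatory integrals at all pairs of frequencies for which the phase
has no nearly stationary point in `X`. -/
lemma pullPhase_estimate (hX : IsOpen X) (hK : IsCompact K) (hKX : K ⊆ X) {ψ : EucSp n → ℂ}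
    (hψ : ContDiff ℝ ∞ ψ) (hψK : ∀ x ∉ K, ψ x = 0) {f : Eps → EucSp n → EucSp m}
    (hf : ∀ J, SlowBdd toZero id X J f) {s : Eps → ℝ} (hs : SlowOn toZero id s) (k : ℕ) :
    ∃ C : ℝ, 0 ≤ C ∧ ∀ᶠ ε in toZero, ∀ (η : EucSp m) (ζ : EucSp n), 0 < ‖η‖ + ‖ζ‖ →
      (∀ x ∈ X, ‖η‖ + ‖ζ‖ ≤ s ε * ‖transJac (f ε) x η - ζ‖) →
      (1 + (‖η‖ + ‖ζ‖)) ^ k * ‖∫ x, ψ x * osc (pullPhase (f ε) η ζ) 1 x‖ ≤ C * (ε : ℝ)⁻¹ := by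
  -- The uniformity in the frequencies is obtained by making them part of the index set.
  set A : Set (Eps × EucSp m × EucSp n) := {i | 0 < ‖i.2.1‖ + ‖i.2.2‖ ∧
    ∀ x ∈ X, ‖i.2.1‖ + ‖i.2.2‖ ≤ s i.1 * ‖transJac (f i.1) x i.2.1 - i.2.2‖} with hA
  set L : Filter (Eps × EucSp m × EucSp n) := Filter.comap Prod.fst toZero ⊓ 𝓟 A with hL
  have hfst : Tendsto Prod.fst L toZero := tendsto_comap.mono_left inf_le_left
  have hAL : ∀ᶠ i in L, i ∈ A := mem_inf_of_right (mem_principal_self A)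
  have hfL : ∀ J, SlowBdd L Prod.fst X J fun i => f i.1 := fun J => (hf J).comap hfst
  have hsL : SlowOn L Prod.fst fun i => s i.1 := hs.comap hfst
  set θ : Eps × EucSp m × EucSp n → EucSp n → ℝ := fun i x =>
    (‖i.2.1‖ + ‖i.2.2‖)⁻¹ * pullPhase (f i.1) i.2.1 i.2.2 x with hθdef
  have hθ : ∀ᶠ i in L, ContDiffOn ℝ ∞ (θ i) X := by
    filter_upwards [(hfL 0).smooth] with i hi
    exact contDiffOn_const.mul (contDiffOn_const.mul
      ((contDiffOn_const.inner ℝ hi).sub (contDiffOn_const.inner ℝ contDiffOn_id)))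
  have hdiff : ∀ᶠ i in L, ∀ x ∈ X, DifferentiableAt ℝ (f i.1) x := by
    filter_upwards [(hfL 0).smooth] with i hi x hx
    exact (hi.contDiffAt (hX.mem_nhds hx)).differentiableAt (by simp)
  have hcoef : ∀ i ∈ A, ∀ r : ℝ, r ≤ ‖i.2.1‖ + ‖i.2.2‖ →
      |(‖i.2.1‖ + ‖i.2.2‖)⁻¹ * (2 * Real.pi)| * r ≤ 2 * Real.pi := by
    intro i hi r hr
    rw [abs_of_pos (mul_pos (inv_pos.2 hi.1) (by positivity)), mul_right_comm]
    refine mul_le_of_le_one_left (by positivity) ?_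
    rw [inv_mul_le_iff₀ hi.1, mul_one]
    exact hr
  have hdθ : ∀ J, SlowBdd L Prod.fst X J fun i => fderiv ℝ (θ i) := fun J => by
    have h1 : SlowBdd L Prod.fst X J fun i x =>
        (ContinuousLinearMap.compL ℝ (EucSp n) (EucSp m) ℝ
          (((‖i.2.1‖ + ‖i.2.2‖)⁻¹ * (2 * Real.pi)) • innerSL ℝ i.2.1)) (fderiv ℝ (f i.1) x) := by
      refine ((hfL (J + 1)).fderiv hX).clm_comp hX (SlowOn.const (2 * Real.pi)) ?_
      filter_upwards [hAL] with i hi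
      refine (ContinuousLinearMap.le_of_opNorm_le _ (ContinuousLinearMap.norm_compL_le _ _ _ _)
        _).trans ?_
      rw [one_mul, norm_smul, innerSL_apply_norm, Real.norm_eq_abs]
      exact hcoef i hi _ (le_add_of_nonneg_right (norm_nonneg _))
    have h2 : SlowBdd L Prod.fst X J fun i (_ : EucSp n) =>
        -(((‖i.2.1‖ + ‖i.2.2‖)⁻¹ * (2 * Real.pi)) • innerSL ℝ i.2.2) := by
      refine SlowBdd.const J (SlowOn.const (2 * Real.pi)) ?_
      filter_upwards [hAL] with i hi
      rw [norm_neg, norm_smul, innerSL_apply_norm, Real.norm_eq_abs]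
      exact hcoef i hi _ (le_add_of_nonneg_left (norm_nonneg _))
    refine (h1.add hX h2).congr hX ?_
    filter_upwards [hdiff] with i hi x hx
    rw [hθdef, (pullPhase_hasFDerivAt (hi x hx) _ _ _).fderiv, sub_eq_add_neg]
    rfl
  have hsθ : ∀ᶠ i in L, ∀ x ∈ X,
      1 ≤ s i.1 ^ 2 * ∑ j, fderiv ℝ (θ i) x (EuclideanSpace.single j 1) ^ 2 := by
    filter_upwards [hdiff, hAL] with i hi hiA x hx
    rw [sum_fderiv_pullPhase_sq (hi x hx)]
    have h1 := pow_le_pow_left₀ hiA.1.le (hiA.2 x hx) 2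
    have h2 : (1 : ℝ) ≤ (2 * Real.pi) ^ 2 := one_le_pow₀ (by linarith [Real.two_le_pi])
    have h3 : 1 ≤ ((‖i.2.1‖ + ‖i.2.2‖)⁻¹) ^ 2 *
        (s i.1 * ‖transJac (f i.1) x i.2.1 - i.2.2‖) ^ 2 := by
      rw [inv_pow, ← div_eq_inv_mul, one_le_div (by have := hiA.1; positivity)]
      exact h1
    calc (1 : ℝ) ≤ (2 * Real.pi) ^ 2 * (((‖i.2.1‖ + ‖i.2.2‖)⁻¹) ^ 2 *
        (s i.1 * ‖transJac (f i.1) x i.2.1 - i.2.2‖) ^ 2) := one_le_mul_of_one_le_of_one_le h2 h3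
      _ = _ := by ring
  have hψb : ∀ k, SlowBdd L Prod.fst X k fun _ => ψ := fun k => by
    refine ⟨Eventually.of_forall fun _ => hψ.contDiffOn, fun j _ => ?_⟩
    obtain ⟨B, hB⟩ := hK.exists_bound_of_continuousOn (f := iteratedFDeriv ℝ j ψ)
      (hψ.continuous_iteratedFDeriv (by exact_mod_cast le_top)).continuousOn
    refine ⟨fun _ => |B|, SlowOn.const _, Eventually.of_forall fun _ x _ => ?_⟩
    by_cases hx : x ∈ K
    · exact (hB x hx).trans (le_abs_self B)
    · rw [iteratedFDeriv_zero_off hK.isClosed hψK j x hx, norm_zero]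
      exact abs_nonneg _
  have main : ∀ k, ∃ S, SlowOn L Prod.fst S ∧ ∀ᶠ i in L, ∀ l : ℝ, 0 < l →
      l ^ k * ‖∫ x, ψ x * osc (θ i) l x‖ ≤ S i := fun k =>
    nonstationary_phase hX hK hKX hθ hdθ (hsL.pow 2) hsθ k (hψb k)
      (Eventually.of_forall fun _ => hψK)
  obtain ⟨S, hS, h1⟩ := main k
  obtain ⟨S', hS', h2⟩ := main 0
  obtain ⟨C, hC0, hC⟩ := ((hS.add hS').mul (SlowOn.const (2 ^ (k - 1)))).eventually_le
  refine ⟨C, hC0, ?_⟩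
  have hall : ∀ᶠ i in L, (1 + (‖i.2.1‖ + ‖i.2.2‖)) ^ k *
      ‖∫ x, ψ x * osc (pullPhase (f i.1) i.2.1 i.2.2) 1 x‖ ≤ C * (i.1 : ℝ)⁻¹ := by
    filter_upwards [h1, h2, hC, hAL] with i h1 h2 h3 hiA
    have e : osc (pullPhase (f i.1) i.2.1 i.2.2) 1 = osc (θ i) (‖i.2.1‖ + ‖i.2.2‖) := by
      ext x
      simp only [osc, hθdef, one_mul]
      rw [← mul_assoc, mul_inv_cancel₀ hiA.1.ne', one_mul]
    rw [e]
    have e1 := h1 _ hiA.1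
    have e2 := h2 _ hiA.1
    rw [pow_zero, one_mul] at e2
    calc _ ≤ (2 ^ (k - 1) * (1 ^ k + (‖i.2.1‖ + ‖i.2.2‖) ^ k)) *
          ‖∫ x, ψ x * osc (θ i) (‖i.2.1‖ + ‖i.2.2‖) x‖ :=
          mul_le_mul_of_nonneg_right (add_pow_le zero_le_one hiA.1.le k) (norm_nonneg _)
      _ = 2 ^ (k - 1) * ((‖i.2.1‖ + ‖i.2.2‖) ^ k *
            ‖∫ x, ψ x * osc (θ i) (‖i.2.1‖ + ‖i.2.2‖) x‖ +
            ‖∫ x, ψ x * osc (θ i) (‖i.2.1‖ + ‖i.2.2‖) x‖) := by rw [one_pow]; ring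
      _ ≤ 2 ^ (k - 1) * (S i + S' i) := by gcongr
      _ = (S i + S' i) * 2 ^ (k - 1) := mul_comm _ _
      _ ≤ _ := (le_abs_self _).trans h3
  rw [hL, eventually_inf_principal, eventually_comap] at hall
  filter_upwards [hall] with ε hε η ζ h0 h1
  exact hε (ε, η, ζ) rfl ⟨h0, h1⟩

/-- Fourier inversion and Fubini. -/
lemma fourier_comp (hX : IsOpen X) (hK : IsCompact K) (hKX : K ⊆ X) {ψ : EucSp n → ℂ}
    (hψ : Continuous ψ) (hψK : ∀ x ∉ K, ψ x = 0) {h : EucSp n → EucSp m} (hh : ContinuousOn h X)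
    {w : EucSp m → ℂ} (hw : Continuous w) (hwi : Integrable w) (hwf : Integrable (𝓕 w))
    (ζ : EucSp n) :
    𝓕 (fun x => ψ x * w (h x)) ζ = ∫ η, 𝓕 w η * ∫ x, ψ x * osc (pullPhase h η ζ) 1 x := by
  have hinv : ∀ y, w y = ∫ η, Complex.exp (((2 * Real.pi * ⟪η, y⟫_ℝ : ℝ) : ℂ) * Complex.I) •
      𝓕 w η := fun y => by
    rw [← Real.fourierInv_eq', hw.fourierInv_fourier_eq hwi hwf]
  have hwc : Continuous (𝓕 w) :=
    VectorFourier.fourierIntegral_continuous Real.continuous_fourierChar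
      (by exact continuous_inner) hwi
  have hcont : Continuous fun p : EucSp n × EucSp m =>
      𝓕 w p.2 * (ψ p.1 * osc (pullPhase h p.2 ζ) 1 p.1) := by
    refine continuous_of_zero_off (X := X ×ˢ Set.univ) (K := K ×ˢ Set.univ)
      (hX.prod isOpen_univ) (hK.isClosed.prod isClosed_univ) (prod_mono hKX le_rfl) ?_ ?_
    · have h1 : ContinuousOn (fun p : EucSp n × EucSp m => h p.1) (X ×ˢ Set.univ) :=
        hh.comp continuousOn_fst fun p hp => hp.1
      refine (hwc.comp continuous_snd).continuousOn.mul
        ((hψ.comp continuous_fst).continuousOn.mul ?_)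
      refine Complex.continuous_exp.comp_continuousOn (continuousOn_const.mul
        (Complex.continuous_ofReal.comp_continuousOn (continuousOn_const.mul
        (continuousOn_const.mul (((continuousOn_snd.inner h1).sub ?_))))))
      exact (continuous_const.inner continuous_fst).continuousOn
    · intro p hp
      rw [hψK p.1 fun hK => hp ⟨hK, mem_univ _⟩]
      simp
  have hψi : Integrable ψ := hψ.integrable_of_hasCompactSupport (HasCompactSupport.intro hK hψK)
  have hint : Integrable (Function.uncurry fun (x : EucSp n) (η : EucSp m) =>
      𝓕 w η * (ψ x * osc (pullPhase h η ζ) 1 x)) (volume.prod volume) := by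
    refine (hψi.mul_prod hwf).mono hcont.aestronglyMeasurable (Eventually.of_forall fun p => ?_)
    simp only [Function.uncurry]
    rw [norm_mul, norm_mul, norm_osc, mul_one, norm_mul, mul_comm]
  rw [Real.fourier_eq']
  calc _ = ∫ x, ∫ η, 𝓕 w η * (ψ x * osc (pullPhase h η ζ) 1 x) := by
        refine integral_congr_ae (Eventually.of_forall fun x => ?_)
        simp only
        rw [hinv (h x), ← integral_const_mul, ← integral_smul]
        refine integral_congr_ae (Eventually.of_forall fun η => ?_)
        simp only [smul_eq_mul, osc, pullPhase]
        rw [mul_left_comm, ← mul_assoc (Complex.exp _), ← Complex.exp_add, mul_comm (𝓕 w η),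
          mul_assoc (ψ x)]
        congr 3
        rw [real_inner_comm x ζ]
        push_cast
        ring
    _ = ∫ η, ∫ x, 𝓕 w η * (ψ x * osc (pullPhase h η ζ) 1 x) := integral_integral_swap hint
    _ = _ := by simp_rw [integral_const_mul]

/-- The central microlocal estimate. Every plane wave in the Fourier decomposition of `w_ε` either
has a frequency `η` with direction in `Γ`, where the Fourier transform of `w_ε` decreases rapidly,
or it produces a non-stationary phase when it is composed with `f_ε` and tested against directions
in `Ξ`. In the first case `|ζ|` may be assumed to be at most a slow scaled multiple of `|η|`, for
otherwise the phase is again non-stationary. -/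
theorem rapidlyDecreasing_comp (hX : IsOpen X) (hK : IsCompact K) (hKX : K ⊆ X)
    {ψ : EucSp n → ℂ} (hψ : ContDiff ℝ ∞ ψ) (hψK : ∀ x ∉ K, ψ x = 0)
    {f : Eps → EucSp n → EucSp m} (hf : ∀ J, SlowBdd toZero id X J f)
    {w : Eps → EucSp m → ℂ} (hw : ModCpt w) {Γ : Set (USphere m)}
    (hΓ : RapidlyDecreasing (fun ε => fourierOn Set.univ (w ε)) Γ) {Ξ : Set (USphere n)}
    {s : Eps → ℝ} (hs : SlowOn toZero id s)
    (hph : ∀ᶠ ε in toZero, ∀ x ∈ X, ∀ η : USphere m, η ∉ Γ → ∀ ξ ∈ Ξ, ∀ a b : ℝ, 0 ≤ a → 0 ≤ b →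
      a + b ≤ s ε * ‖a • transJac (f ε) x (η : EucSp m) - b • (ξ : EucSp n)‖) :
    RapidlyDecreasing (fun ε => fourierOn Set.univ fun x => ψ x * w ε (f ε x)) Ξ := by
  obtain ⟨N₁, hN₁⟩ := rapidlyDecreasing_iff.1 hΓ
  obtain ⟨N₀, C₀, hC₀, h0⟩ := hw.fourier_decay 0
  obtain ⟨s₁, hs₁, h1⟩ := ((hf 1).fderiv hX).zero_order
  refine rapidlyDecreasing_iff.2 ⟨N₀ + N₁ + 1, fun p => ?_⟩
  -- `p` powers pay for the weight in `ζ` and `m + 1` further ones make the `η`-integral converge.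
  -- The summand `4` covers the frequencies with `|ζ|` much larger than `|ᵗdf_ε(x)η|`, where the
  -- phase is non-stationary for trivial reasons.
  obtain ⟨C₁, hC₁, h2⟩ := pullPhase_estimate hX hK hKX hψ hψK hf (hs.abs.add (SlowOn.const 4))
    (p + (m + 1))
  obtain ⟨C₂, hC₂, h3⟩ := hN₁ (p + (m + 1))
  obtain ⟨C₃, hC₃, h4⟩ := (((hs₁.abs.mul (SlowOn.const 2)).add
    (SlowOn.const 2)).pow p).eventually_le
  obtain ⟨N₂, C₄, hC₄, h5⟩ := hw.fourier_decay (m + 1)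
  have hI : Integrable fun η : EucSp m => ((1 + ‖η‖) ^ (m + 1))⁻¹ := by
    have := integrable_one_add_norm (E := EucSp m) (μ := volume) (r := (m + 1 : ℕ)) (by simp)
    refine this.congr (Eventually.of_forall fun η => ?_)
    simp only
    rw [Real.rpow_neg (by positivity), Real.rpow_natCast]
  set Ψ := ∫ x, ‖ψ x‖
  have hΨ : 0 ≤ Ψ := integral_nonneg fun x => norm_nonneg _
  refine ⟨(C₁ * C₀ + C₂ * C₃ * Ψ) * ∫ η : EucSp m, ((1 + ‖η‖) ^ (m + 1))⁻¹,
    mul_nonneg (by positivity) (integral_nonneg fun η => by positivity), ?_⟩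
  filter_upwards [h0, h1, h2, h3, h4, h5, hph, (hf 0).smooth] with ε h0 h1 h2 h3 h4 h5 hph hsm
    t ht ξ hξ
  have hε : (0 : ℝ) < (ε : ℝ)⁻¹ := inv_pos.2 ε.2.1
  have hwf : Integrable (𝓕 (w ε)) := by
    have hc : Continuous (𝓕 (w ε)) :=
      VectorFourier.fourierIntegral_continuous Real.continuous_fourierChar
        (by exact continuous_inner) (hw.integrable ε)
    refine (hI.const_mul (C₄ * (ε : ℝ)⁻¹ ^ N₂)).mono' hc.aestronglyMeasurable
      (Eventually.of_forall fun η => ?_)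
    rw [← div_eq_mul_inv, le_div_iff₀ (by positivity), mul_comm]
    exact h5 η
  rw [fourier_comp hX hK hKX hψ.continuous hψK hsm.continuousOn (hw.smooth ε).continuous
    (hw.integrable ε) hwf]
  have hξt : ‖t • (ξ : EucSp n)‖ = t := by
    rw [norm_smul, Real.norm_of_nonneg ht.le, norm_eq_of_mem_sphere, mul_one]
  set I : EucSp m → ℂ := fun η => ∫ x, ψ x * osc (pullPhase (f ε) η (t • (ξ : EucSp n))) 1 x
    with hIdef
  have hIb : ∀ η, ‖I η‖ ≤ Ψ := fun η => by
    refine (norm_integral_le_integral_norm _).trans_eq ?_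
    simp_rw [norm_mul, norm_osc, mul_one]
    rfl
  have key : ∀ η, (1 + t) ^ p * (1 + ‖η‖) ^ (m + 1) * ‖𝓕 (w ε) η * I η‖ ≤
      (C₁ * C₀ + C₂ * C₃ * Ψ) * (ε : ℝ)⁻¹ ^ (N₀ + N₁ + 1) := by
    intro η
    have hp1 : (ε : ℝ)⁻¹ ^ (N₀ + 1) ≤ (ε : ℝ)⁻¹ ^ (N₀ + N₁ + 1) := pow_inv_le_pow_inv (by omega)
    have hp2 : (ε : ℝ)⁻¹ ^ (N₁ + 1) ≤ (ε : ℝ)⁻¹ ^ (N₀ + N₁ + 1) := pow_inv_le_pow_inv (by omega)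
    by_cases hns : ∀ x ∈ X, ‖η‖ + ‖t • (ξ : EucSp n)‖ ≤
        (|s ε| + 4) * ‖transJac (f ε) x η - t • (ξ : EucSp n)‖
    · have e1 := h2 η (t • (ξ : EucSp n)) (by rw [hξt]; positivity) hns
      rw [hξt] at e1
      have e0 := h0 η
      rw [pow_zero, one_mul] at e0
      calc _ ≤ (1 + (‖η‖ + t)) ^ p * (1 + (‖η‖ + t)) ^ (m + 1) * ‖𝓕 (w ε) η * I η‖ := by
            gcongr
            · linarith [norm_nonneg η]
            · linarith
        _ = ‖𝓕 (w ε) η‖ * ((1 + (‖η‖ + t)) ^ (p + (m + 1)) * ‖I η‖) := by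
          rw [norm_mul, pow_add]; ring
        _ ≤ (C₀ * (ε : ℝ)⁻¹ ^ N₀) * (C₁ * (ε : ℝ)⁻¹) := by gcongr
        _ = C₁ * C₀ * (ε : ℝ)⁻¹ ^ (N₀ + 1) := by ring
        _ ≤ (C₁ * C₀ + C₂ * C₃ * Ψ) * (ε : ℝ)⁻¹ ^ (N₀ + N₁ + 1) := by
          refine mul_le_mul ?_ hp1 (by positivity) (by positivity)
          have : 0 ≤ C₂ * C₃ * Ψ := by positivity
          linarith
    · push Not at hns
      obtain ⟨x, hx, hlt⟩ := hns
      rw [hξt] at hlt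
      have hs0 := abs_nonneg (s ε)
      have hη : η ≠ 0 := by
        rintro rfl
        rw [map_zero, zero_sub, norm_neg, hξt, norm_zero, zero_add] at hlt
        nlinarith
      have hη0 : 0 < ‖η‖ := norm_pos_iff.2 hη
      set υ : USphere m := ⟨‖η‖⁻¹ • η, by
        rw [mem_sphere_zero_iff_norm, norm_smul, norm_inv, norm_norm, inv_mul_cancel₀ hη0.ne']⟩
      have hυ : ‖η‖ • (υ : EucSp m) = η := by
        change ‖η‖ • (‖η‖⁻¹ • η) = η
        rw [smul_smul, mul_inv_cancel₀ hη0.ne', one_smul]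
      have hυΓ : υ ∈ Γ := by
        by_contra hυΓ
        have := hph x hx υ hυΓ ξ hξ ‖η‖ t hη0.le ht.le
        rw [← map_smul, hυ] at this
        have h6 := norm_nonneg (transJac (f ε) x η - t • (ξ : EucSp n))
        have h7 := mul_le_mul_of_nonneg_right (le_abs_self (s ε)) h6
        nlinarith
      have hT : ‖transJac (f ε) x η‖ ≤ |s₁ ε| * ‖η‖ := by
        refine ContinuousLinearMap.le_of_opNorm_le _ ?_ η
        rw [transJac, LinearIsometryEquiv.norm_map]
        exact (h1 x hx).trans (le_abs_self _)
      have htη : t ≤ (2 * |s₁ ε| + 1) * ‖η‖ := by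
        by_contra hcon
        push Not at hcon
        have h6 : t - ‖transJac (f ε) x η‖ ≤ ‖transJac (f ε) x η - t • (ξ : EucSp n)‖ := by
          have := norm_sub_norm_le (t • (ξ : EucSp n)) (transJac (f ε) x η)
          rwa [hξt, norm_sub_rev] at this
        have h7 := norm_nonneg (transJac (f ε) x η - t • (ξ : EucSp n))
        nlinarith [abs_nonneg (s₁ ε)]
      have e1 := h3 ‖η‖ hη0 υ hυΓ
      rw [hυ] at e1
      have e2 : 1 + t ≤ (|s₁ ε| * 2 + 2) * (1 + ‖η‖) := by nlinarith [abs_nonneg (s₁ ε)]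
      calc _ ≤ ((|s₁ ε| * 2 + 2) * (1 + ‖η‖)) ^ p * (1 + ‖η‖) ^ (m + 1) *
              (‖𝓕 (w ε) η‖ * Ψ) := by
            rw [norm_mul]
            gcongr
            exact hIb η
        _ = (|s₁ ε| * 2 + 2) ^ p * ((1 + ‖η‖) ^ (p + (m + 1)) * ‖𝓕 (w ε) η‖) * Ψ := by
          rw [mul_pow, pow_add]; ring
        _ ≤ (C₃ * (ε : ℝ)⁻¹) * (C₂ * (ε : ℝ)⁻¹ ^ N₁) * Ψ := by
          have := (le_abs_self _).trans h4
          gcongr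
          exact this
        _ = C₂ * C₃ * Ψ * (ε : ℝ)⁻¹ ^ (N₁ + 1) := by ring
        _ ≤ (C₁ * C₀ + C₂ * C₃ * Ψ) * (ε : ℝ)⁻¹ ^ (N₀ + N₁ + 1) := by
          refine mul_le_mul ?_ hp2 (by positivity) (by positivity)
          have : 0 ≤ C₁ * C₀ := by positivity
          linarith
  have hpt : (0 : ℝ) < (1 + t) ^ p := by positivity
  have hfin := norm_integral_le_of_norm_le (f := fun η => 𝓕 (w ε) η * I η)
    (hI.const_mul ((C₁ * C₀ + C₂ * C₃ * Ψ) * (ε : ℝ)⁻¹ ^ (N₀ + N₁ + 1) / (1 + t) ^ p))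
    (Eventually.of_forall fun η => by
      rw [← div_eq_mul_inv, div_div, le_div_iff₀ (by positivity), mul_comm]
      exact key η)
  rw [integral_const_mul] at hfin
  calc _ ≤ (1 + t) ^ p * _ := mul_le_mul_of_nonneg_left hfin hpt.le
    _ = _ := by field_simp

end Pullback

/-! ### Representatives -/

lemma IsNegligible.mono {E F : Type*} [NormedAddCommGroup E] [NormedAddCommGroup F] {U W : Set E}
    {r : Eps → E → F} (h : IsNegligible U r) (hWU : W ⊆ U) :
    IsNegligible W r := fun K hK hKW => h K hK (hKW.trans hWU)

lemma IsNegligible.add {E F : Type*} [NormedAddCommGroup E] [NormedAddCommGroup F] {U : Set E}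
    {r s : Eps → E → F} (hr : IsNegligible U r)
    (hs : IsNegligible U s) : IsNegligible U fun ε x => r ε x + s ε x := by
  intro K hK hKU q
  obtain ⟨C, hC⟩ := hr K hK hKU q
  obtain ⟨D, hD⟩ := hs K hK hKU q
  refine ⟨C + D, ?_⟩
  filter_upwards [hC, hD] with ε h1 h2 x hx
  rw [add_mul]
  exact (norm_add_le _ _).trans (add_le_add (h1 x hx) (h2 x hx))

section Rep

variable {E : Type*} [NormedAddCommGroup E] [NormedSpace ℝ E]
variable {F : Type*} [NormedAddCommGroup F] [NormedSpace ℝ F]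
variable {Ω : TopologicalSpace.Opens E}

lemma exists_isRep (u : Colombeau Ω F) : ∃ r, IsRep u r := by
  obtain ⟨r, hr⟩ := QuotientAddGroup.mk_surjective u
  exact ⟨r, r.2, hr⟩

lemma IsRep.isModerate {u : Colombeau Ω F} {r : Eps → E → F} (h : IsRep u r) :
    IsModerate (Ω : Set E) r := h.1

lemma IsRep.unique {u v : Colombeau Ω F} {r : Eps → E → F} (h : IsRep u r) (h' : IsRep v r) :
    u = v := by
  obtain ⟨_, rfl⟩ := h
  obtain ⟨_, rfl⟩ := h'
  rfl

lemma IsRep.negligible_sub {u : Colombeau Ω F} {r r' : Eps → E → F} (h : IsRep u r)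
    (h' : IsRep u r') : IsNegligible (Ω : Set E) fun ε x => r' ε x - r ε x := by
  obtain ⟨h1, rfl⟩ := h
  obtain ⟨h2, h3⟩ := h'
  have h4 := QuotientAddGroup.eq.1 h3.symm
  intro K hK hKΩ q
  obtain ⟨C, hC⟩ := h4 K hK hKΩ q
  refine ⟨C, hC.mono fun ε hε x hx => ?_⟩
  change ‖r' ε x - r ε x‖ ≤ _
  rw [sub_eq_neg_add]
  exact hε x hx

lemma IsRep.of_negligible_sub {u : Colombeau Ω F} {r r' : Eps → E → F} (h : IsRep u r)
    (hr' : IsModerate (Ω : Set E) r')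
    (hn : IsNegligible (Ω : Set E) fun ε x => r' ε x - r ε x) : IsRep u r' := by
  obtain ⟨h1, rfl⟩ := h
  refine ⟨hr', (QuotientAddGroup.eq.2 fun K hK hKΩ q => ?_).symm⟩
  obtain ⟨C, hC⟩ := hn K hK hKΩ q
  refine ⟨C, hC.mono fun ε hε x hx => ?_⟩
  change ‖-r ε x + r' ε x‖ ≤ _
  rw [← sub_eq_neg_add]
  exact hε x hx

lemma IsRep.smoothMul {u : Colombeau Ω ℂ} {r : Eps → E → ℂ} (h : IsRep u r) {φ : E → ℂ}
    (hφ : ContDiff ℝ ∞ φ) : IsRep (smoothMul φ hφ u) fun ε x => φ x * r ε x := by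
  obtain ⟨h1, rfl⟩ := h
  exact ⟨smoothMul_mem Ω φ hφ h1, rfl⟩

end Rep

lemma eventually_mul_eps_le (C : ℝ) {δ : ℝ} (hδ : 0 < δ) :
    ∀ᶠ ε : Eps in toZero, C * (ε : ℝ) ≤ δ := by
  have h : Tendsto (fun x : ℝ => C * x) (𝓝 0) (𝓝 (C * 0)) := by
    exact (continuous_const.mul continuous_id).tendsto 0
  rw [mul_zero] at h
  exact ((h.eventually (ge_mem_nhds hδ)).comap (fun ε : Eps => (ε : ℝ)) :)

/-! ### The pullback is well defined -/

section WellDefined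

variable {n m : ℕ} {Ω₁ : TopologicalSpace.Opens (EucSp n)} {Ω₂ : TopologicalSpace.Opens (EucSp m)}

lemma IsCBoundedRep.mapsTo {g : Colombeau Ω₁ (EucSp m)} {f : Eps → EucSp n → EucSp m}
    (hf : IsCBoundedRep Ω₂ g f) (ε : Eps) : MapsTo (f ε) (Ω₁ : Set (EucSp n)) Ω₂ := fun x hx => by
  obtain ⟨K', _, hK', h⟩ := hf.2 {x} isCompact_singleton (singleton_subset_iff.2 hx)
  exact hK' (h ε rfl)

lemma IsCBoundedRep.isModerate_comp {g : Colombeau Ω₁ (EucSp m)} {f : Eps → EucSp n → EucSp m}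
    (hf : IsCBoundedRep Ω₂ g f) {r : Eps → EucSp m → ℂ}
    (hr : IsModerate (Ω₂ : Set (EucSp m)) r) :
    IsModerate (Ω₁ : Set (EucSp n)) fun ε x => r ε (f ε x) := by
  have hfm := hf.1.isModerate
  refine ⟨fun ε => (hr.1 ε).comp (hfm.1 ε) (hf.mapsTo ε), fun K hK hKΩ k => ?_⟩
  obtain ⟨K', hK', hK'Ω, hKK'⟩ := hf.2 K hK hKΩ
  choose N C hC using hr.2 K' hK' hK'Ω
  choose M D hD using hfm.2 K hK hKΩ
  set R := Finset.range (k + 1)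
  set N₀ := R.sup N
  set M₀ := R.sup M
  -- The summand `1` makes the bound for the derivatives of `f_ε` at least `1`, so that it is
  -- dominated by its powers, as the estimate for compositions requires.
  refine ⟨N₀ + M₀ * k, k.factorial * (∑ j ∈ R, |C j|) * (1 + ∑ j ∈ R, |D j|) ^ k, ?_⟩
  filter_upwards [(Finset.eventually_all R).2 fun j _ => hC j,
    (Finset.eventually_all R).2 fun j _ => hD j] with ε h1 h2 x hx
  have hε : ∀ a : ℕ, (0 : ℝ) ≤ (ε : ℝ)⁻¹ ^ a := fun a => pow_nonneg (inv_nonneg.2 ε.2.1.le) a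
  have hε1 : (1 : ℝ) ≤ (ε : ℝ)⁻¹ ^ M₀ := one_le_pow₀ (one_le_inv_eps ε)
  have hle : ∀ (c : ℕ → ℝ), ∀ j ∈ R, |c j| ≤ ∑ j ∈ R, |c j| := fun c j hj =>
    Finset.single_le_sum (f := fun j => |c j|) (fun _ _ => abs_nonneg _) hj
  have hsum : ∀ (c : ℕ → ℝ), 0 ≤ ∑ j ∈ R, |c j| := fun c => Finset.sum_nonneg fun _ _ => abs_nonneg _
  have := norm_iteratedFDerivWithin_comp_le (𝕜 := ℝ) (N := (∞ : WithTop ℕ∞)) (hr.1 ε) (hfm.1 ε)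
    (n := k) (by exact_mod_cast le_top) (Ω₂.isOpen.uniqueDiffOn (𝕜 := ℝ))
    (Ω₁.isOpen.uniqueDiffOn (𝕜 := ℝ)) (hf.mapsTo ε) (hKΩ hx)
    (C := (∑ j ∈ R, |C j|) * (ε : ℝ)⁻¹ ^ N₀) (D := (1 + ∑ j ∈ R, |D j|) * (ε : ℝ)⁻¹ ^ M₀)
    (fun i hi => by
      have hiR : i ∈ R := Finset.mem_range.2 (by omega)
      rw [iteratedFDerivWithin_of_isOpen _ Ω₂.isOpen (hf.mapsTo ε (hKΩ hx))]
      exact (h1 i hiR _ (hKK' ε hx)).trans (le_inv_eps_pow_of_le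
        ((le_abs_self _).trans (hle C i hiR)) (hsum C) (Finset.le_sup hiR)))
    (fun i hi1 hi => by
      have hiR : i ∈ R := Finset.mem_range.2 (by omega)
      rw [iteratedFDerivWithin_of_isOpen _ Ω₁.isOpen (hKΩ hx)]
      have e1 := (h2 i hiR x hx).trans (le_inv_eps_pow_of_le (b := M₀)
        (D := 1 + ∑ j ∈ R, |D j|)
        (by linarith [le_abs_self (D i), hle D i hiR]) (by linarith [hsum D]) (Finset.le_sup hiR))
      have e2 : 1 ≤ (1 + ∑ j ∈ R, |D j|) * (ε : ℝ)⁻¹ ^ M₀ :=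
        one_le_mul_of_one_le_of_one_le (by linarith [hsum D]) hε1
      exact e1.trans (le_self_pow₀ e2 (by omega)))
  rw [iteratedFDerivWithin_of_isOpen _ Ω₁.isOpen (hKΩ hx)] at this
  refine this.trans_eq ?_
  rw [mul_pow, pow_add, pow_mul]
  ring

/-- Change of the c-bounded representative, by the mean value inequality on small balls around
the values of `f_ε`. -/
lemma IsCBoundedRep.negligible_comp_sub {g : Colombeau Ω₁ (EucSp m)}
    {f f' : Eps → EucSp n → EucSp m}
    (hf : IsCBoundedRep Ω₂ g f) (hf' : IsCBoundedRep Ω₂ g f') {r : Eps → EucSp m → ℂ}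
    (hr : IsModerate (Ω₂ : Set (EucSp m)) r) :
    IsNegligible (Ω₁ : Set (EucSp n)) fun ε x => r ε (f' ε x) - r ε (f ε x) := by
  intro K hK hKΩ q
  obtain ⟨K', hK', hK'Ω, hKK'⟩ := hf.2 K hK hKΩ
  obtain ⟨δ, hδ, hδΩ⟩ := hK'.exists_cthickening_subset_open Ω₂.isOpen hK'Ω
  obtain ⟨N, C, hC⟩ := hr.2 _ (hK'.cthickening (r := δ)) hδΩ 1
  obtain ⟨D, hD⟩ := hf.1.negligible_sub hf'.1 K hK hKΩ (q + N)
  obtain ⟨D', hD'⟩ := hf.1.negligible_sub hf'.1 K hK hKΩ 1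
  refine ⟨|C| * |D|, ?_⟩
  filter_upwards [hC, hD, hD', eventually_mul_eps_le D' hδ] with ε h1 h2 h3 h4 x hx
  have hε : (0 : ℝ) < ε := ε.2.1
  have hball : Metric.closedBall (f ε x) δ ⊆ Metric.cthickening δ K' :=
    Metric.closedBall_subset_cthickening (hKK' ε hx) δ
  have hmem : f' ε x ∈ Metric.closedBall (f ε x) δ := by
    rw [mem_closedBall_iff_norm]
    exact (h3 x hx).trans (by rwa [pow_one])
  have := (convex_closedBall (f ε x) δ).norm_image_sub_le_of_norm_fderiv_le (𝕜 := ℝ)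
    (f := r ε) (C := |C| * (ε : ℝ)⁻¹ ^ N)
    (fun y hy => ((hr.1 ε).contDiffAt (Ω₂.isOpen.mem_nhds (hδΩ (hball hy)))).differentiableAt
      (by simp))
    (fun y hy => by
      rw [← norm_iteratedFDeriv_one]
      exact (h1 y (hball hy)).trans (mul_pow_inv_le le_rfl))
    (Metric.mem_closedBall_self hδ.le) hmem
  calc _ ≤ |C| * (ε : ℝ)⁻¹ ^ N * (|D| * (ε : ℝ) ^ (q + N)) :=
        this.trans (mul_le_mul_of_nonneg_left ((h2 x hx).trans
          (mul_le_mul_of_nonneg_right (le_abs_self D) (by positivity))) (by positivity))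
    _ = |C| * |D| * (ε : ℝ) ^ q * ((ε : ℝ)⁻¹ ^ N * (ε : ℝ) ^ N) := by rw [pow_add]; ring
    _ = _ := by rw [← mul_pow, inv_mul_cancel₀ hε.ne', one_pow, mul_one]

lemma IsCBoundedRep.isRep_comp {g : Colombeau Ω₁ (EucSp m)} {f f' : Eps → EucSp n → EucSp m}
    (hf : IsCBoundedRep Ω₂ g f) (hf' : IsCBoundedRep Ω₂ g f') {u : Colombeau Ω₂ ℂ}
    {r r' : Eps → EucSp m → ℂ} (hr : IsRep u r) (hr' : IsRep u r') {v : Colombeau Ω₁ ℂ}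
    (hv : IsRep v fun ε x => r ε (f ε x)) : IsRep v fun ε x => r' ε (f' ε x) := by
  refine hv.of_negligible_sub (hf'.isModerate_comp hr'.isModerate) ?_
  have h1 : IsNegligible (Ω₁ : Set (EucSp n)) fun ε x => r' ε (f' ε x) - r ε (f' ε x) := by
    intro K hK hKΩ q
    obtain ⟨K', hK', hK'Ω, hKK'⟩ := hf'.2 K hK hKΩ
    obtain ⟨C, hC⟩ := hr.negligible_sub hr' K' hK' hK'Ω q
    exact ⟨C, hC.mono fun ε h x hx => h _ (hKK' ε hx)⟩
  simpa using h1.add (hf.negligible_comp_sub hf' hr.isModerate)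

theorem existsUnique_isPullback {g : Colombeau Ω₁ (EucSp m)} {f : Eps → EucSp n → EucSp m}
    (hf : IsCBoundedRep Ω₂ g f) (u : Colombeau Ω₂ ℂ) :
    ∃! v : Colombeau Ω₁ ℂ, IsPullback g u v := by
  obtain ⟨r, hr⟩ := exists_isRep u
  have hm := hf.isModerate_comp hr.isModerate
  have h0 : IsRep (QuotientAddGroup.mk ⟨_, hm⟩ : Colombeau Ω₁ ℂ) fun ε x => r ε (f ε x) := ⟨hm, rfl⟩
  exact ⟨_, fun f' r' hf' hr' => hf.isRep_comp hf' hr hr' h0, fun v hv => (hv f r hf hr).unique h0⟩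

end WellDefined

/-! ### Regular directions -/

section Regular

variable {n : ℕ} {Ω : TopologicalSpace.Opens (EucSp n)}

/-- A single cutoff whose product with a representative has a rapidly decreasing Fourier transform
near `ξ` excludes `(x, ξ)` from the wave front set. -/
lemma notMem_WF {v : Colombeau Ω ℂ} {V : Eps → EucSp n → ℂ} (hV : IsRep v V) {ψ : EucSp n → ℂ}
    (hψ : ContDiff ℝ ∞ ψ) (hψc : HasCompactSupport ψ) (hψΩ : tsupport ψ ⊆ Ω) {x : EucSp n}
    (hx : ψ x ≠ 0) {ξ : USphere n} {Ξ : Set (USphere n)} (hΞ : Ξ ∈ 𝓝 ξ)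
    (h : RapidlyDecreasing (fun ε => fourierOn Set.univ fun x => ψ x * V ε x) Ξ) :
    (x, ξ) ∉ WF v := by
  rintro ⟨_, hreg⟩
  have h0 : ∀ ε, ∀ x ∉ tsupport ψ, ψ x * V ε x = 0 := fun ε x hx => by
    rw [image_eq_zero_of_notMem_tsupport hx, zero_mul]
  refine hreg ψ hψ hψc hψΩ hx ⟨interior Ξ, isOpen_interior, mem_interior_iff_mem_nhds.2 hΞ,
    _, hV.smoothMul hψ, ⟨tsupport ψ, hψc, hψΩ, fun ε x _ hx => h0 ε x hx⟩, ?_⟩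
  have : ∀ ε, fourierOn (Ω : Set (EucSp n)) (fun x => ψ x * V ε x) =
      fourierOn Set.univ fun x => ψ x * V ε x := fun ε =>
    fourierOn_eq_univ fun x hx => h0 ε x fun hx' => hx (hψΩ hx')
  simp only [this]
  exact h.mono interior_subset

lemma ModCpt.smul {r : Eps → EucSp n → ℂ} (hr : IsModerate (Ω : Set (EucSp n)) r)
    {χ : EucSp n → ℂ} (hχ : ContDiff ℝ ∞ χ) (hχc : HasCompactSupport χ) (hχΩ : tsupport χ ⊆ Ω) :
    ModCpt fun ε x => χ x * r ε x :=
  .of_isModerate Ω.isOpen (smoothMul_mem Ω χ hχ hr) hχc hχΩ fun ε x hx => by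
    rw [image_eq_zero_of_notMem_tsupport hx, zero_mul]

end Regular

instance : toZero.NeBot := by
  refine comap_neBot fun t ht => ?_
  obtain ⟨δ, hδ, h⟩ := Metric.mem_nhds_iff.1 ht
  refine ⟨⟨min 1 (δ / 2), by positivity, min_le_left _ _⟩, h ?_⟩
  rw [Metric.mem_ball, dist_zero_right, Real.norm_of_nonneg (by positivity)]
  exact (min_le_right _ _).trans_lt (by linarith)

/-! ### Points outside generalized graphs -/

lemma tendsto_toZero_of_le {τ : Eps → Eps} (h : ∀ ε, τ ε ≤ ε) : Tendsto τ toZero toZero := by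
  refine tendsto_comap_iff.2 ?_
  exact squeeze_zero (fun ε => (τ ε).2.1.le) (fun ε => h ε) tendsto_comap

/-- Near a pair of points outside the generalized graph, the maps `F_ε` eventually omit a
neighbourhood of the second point. -/
lemma eventually_notMem_of_notMem_genGraph {A B : Type*} [PseudoMetricSpace A]
    [PseudoMetricSpace B] {D : Set A} {R : Set B} {F : Eps → A → B} {a : A} {b : B} (ha : a ∈ D)
    (hb : b ∈ R) (h : (a, b) ∉ genGraph D R F) :
    ∃ U ∈ 𝓝 a, ∃ W ∈ 𝓝 b, ∀ᶠ ε in toZero, ∀ x ∈ U, x ∈ D → F ε x ∉ W := by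
  by_contra hcon
  push Not at hcon
  refine h ⟨ha, hb, ?_⟩
  have : ∀ ε : Eps, ∃ (τ : Eps) (x : A), τ ≤ ε ∧ x ∈ D ∧ dist x a < ε ∧ dist (F τ x) b < ε := by
    intro ε
    have hfr := hcon _ (Metric.ball_mem_nhds a ε.2.1) _ (Metric.ball_mem_nhds b ε.2.1)
    obtain ⟨τ, ⟨x, hx, hxD, hxF⟩, hτ⟩ := (hfr.and_eventually (eventually_toZero_le ε)).exists
    exact ⟨τ, x, hτ, hxD, hx, hxF⟩
  choose τ x hτ hxD hxa hxb using this
  have h0 : Tendsto (fun ε : Eps => (ε : ℝ)) toZero (𝓝 0) := tendsto_comap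
  have hF : Tendsto (fun ε => F (τ ε) (x ε)) toZero (𝓝 b) :=
    tendsto_iff_dist_tendsto_zero.2
      (squeeze_zero (fun ε => dist_nonneg) (fun ε => (hxb ε).le) h0)
  exact ⟨x, hxD, tendsto_iff_dist_tendsto_zero.2
    (squeeze_zero (fun ε => dist_nonneg) (fun ε => (hxa ε).le) h0), τ, tendsto_toZero_of_le hτ,
    hF.mapClusterPt⟩

/-! ### Cutoffs and localization -/

lemma exists_cutoff {n : ℕ} {y : EucSp n} {U : Set (EucSp n)} (hU : U ∈ 𝓝 y) :
    ∃ χ : EucSp n → ℂ, ContDiff ℝ ∞ χ ∧ HasCompactSupport χ ∧ tsupport χ ⊆ U ∧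
      ∀ᶠ z in 𝓝 y, χ z = 1 := by
  obtain ⟨δ, hδ, h⟩ := Metric.nhds_basis_closedBall.mem_iff.1 hU
  let b : ContDiffBump y := ⟨δ / 2, δ, by linarith, by linarith⟩
  have hs : tsupport (fun z => ((b z : ℝ) : ℂ)) ⊆ tsupport b :=
    closure_mono fun z hz => fun h => hz (by simp [h])
  refine ⟨fun z => ((b z : ℝ) : ℂ), Complex.ofRealCLM.contDiff.comp b.contDiff, ?_, ?_, ?_⟩
  · exact b.hasCompactSupport.comp_left (g := fun r : ℝ => (r : ℂ)) Complex.ofReal_zero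
  · exact (hs.trans_eq b.tsupport_eq).trans h
  · filter_upwards [b.eventuallyEq_one] with z hz
    rw [hz]
    simp

section Localization

variable {n : ℕ} {Ω : TopologicalSpace.Opens (EucSp n)}

lemma IsModerate.congr {U : Set (EucSp n)} (hU : IsOpen U) {r s : Eps → EucSp n → ℂ}
    (hr : IsModerate U r) (h : ∀ ε, EqOn (s ε) (r ε) U) : IsModerate U s := by
  refine ⟨fun ε => (hr.1 ε).congr (h ε), fun K hK hKU k => ?_⟩
  obtain ⟨N, C, hC⟩ := hr.2 K hK hKU k
  refine ⟨N, C, hC.mono fun ε hε x hx => ?_⟩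
  have : s ε =ᶠ[𝓝 x] r ε := Filter.eventuallyEq_of_mem (hU.mem_nhds (hKU hx)) (h ε)
  rw [(this.iteratedFDeriv ℝ k).eq_of_nhds]
  exact hε x hx

lemma RapidlyDecreasing.of_eventually_zero {w : Eps → EucSp n → ℂ}
    (h : ∀ᶠ ε in toZero, ∀ x, w ε x = 0) (Γ : Set (USphere n)) :
    RapidlyDecreasing (fun ε => fourierOn Set.univ (w ε)) Γ := by
  refine ⟨0, fun p => ⟨0, h.mono fun ε hε t _ ξ _ => ?_⟩⟩
  simp [fourierOn, hε]

lemma RapidlyDecreasing.fourierOn_add {v w : Eps → EucSp n → ℂ} {Γ : Set (USphere n)}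
    (hv : RapidlyDecreasing (fun ε => fourierOn Set.univ (v ε)) Γ)
    (hw : RapidlyDecreasing (fun ε => fourierOn Set.univ (w ε)) Γ)
    (hvm : ModCpt v) (hwm : ModCpt w) :
    RapidlyDecreasing (fun ε => fourierOn Set.univ fun x => v ε x + w ε x) Γ :=
  (hv.add hw).congr (Eventually.of_forall fun ε => by
    ext ξ
    rw [ColombeauWF.fourierOn_add (hvm.integrable ε) (hwm.integrable ε)])

/-- Smooth functions that do not depend on `ε` form slowly growing families on bounded sets. -/
lemma SlowBdd.of_contDiff {E F : Type*} [NormedAddCommGroup E] [NormedSpace ℝ E]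
    [NormedAddCommGroup F] [NormedSpace ℝ F] {ι : Type*} {L : Filter ι} {e : ι → Eps}
    {X K : Set E} (hK : IsCompact K) (hXK : X ⊆ K) {h : E → F} (hh : ContDiff ℝ ∞ h) (J : ℕ) :
    SlowBdd L e X J fun _ => h := by
  refine ⟨Eventually.of_forall fun _ => hh.contDiffOn, fun j _ => ?_⟩
  obtain ⟨B, hB⟩ := hK.exists_bound_of_continuousOn (f := iteratedFDeriv ℝ j h)
    (hh.continuous_iteratedFDeriv (by exact_mod_cast le_top)).continuousOn
  exact ⟨fun _ => B, SlowOn.const _, Eventually.of_forall fun _ x hx => hB x (hXK hx)⟩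

/-- Unit vectors at a distance of at least `d` span an angle that prevents cancellation. -/
lemma add_le_mul_norm_sub {E : Type*} [NormedAddCommGroup E] [InnerProductSpace ℝ E] {v w : E}
    (hv : ‖v‖ = 1) (hw : ‖w‖ = 1) {d : ℝ} (hd : 0 < d) (hvw : d ≤ ‖v - w‖) {a b : ℝ}
    (ha : 0 ≤ a) (hb : 0 ≤ b) : a + b ≤ 2 / d * ‖a • v - b • w‖ := by
  have h1 : ‖v - w‖ ^ 2 = 2 - 2 * ⟪v, w⟫_ℝ := by
    rw [norm_sub_sq_real, hv, hw]; ring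
  have h2 : ‖a • v - b • w‖ ^ 2 = a ^ 2 - 2 * (a * b) * ⟪v, w⟫_ℝ + b ^ 2 := by
    rw [norm_sub_sq_real, norm_smul, norm_smul, hv, hw, real_inner_smul_left,
      real_inner_smul_right, Real.norm_of_nonneg ha, Real.norm_of_nonneg hb]
    ring
  have h3 : d ^ 2 ≤ ‖v - w‖ ^ 2 := pow_le_pow_left₀ hd.le hvw 2
  have h4 : d ^ 2 ≤ 4 := by
    have h5 := norm_sub_le v w
    rw [hv, hw] at h5
    have := pow_le_pow_left₀ (norm_nonneg _) h5 2
    linarith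
  have h5 : (d / 2 * (a + b)) ^ 2 ≤ ‖a • v - b • w‖ ^ 2 := by
    rw [h2]
    nlinarith [mul_nonneg (sub_nonneg.2 h4) (sq_nonneg (a - b)), mul_nonneg ha hb,
      mul_nonneg (mul_nonneg ha hb) (sub_nonneg.2 h3)]
  have h6 := le_of_sq_le_sq h5 (norm_nonneg _)
  rw [div_mul_eq_mul_div, le_div_iff₀ hd]
  linarith

/-- A regular direction of `u` at `y` is regular for all cutoffs of `u` with supports near `y`,
uniformly in a fixed neighbourhood of the direction. This follows from the estimate for
compositions, applied to the identity map. -/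
lemma exists_rapidlyDecreasing_cutoff {u : Colombeau Ω ℂ} {r : Eps → EucSp n → ℂ}
    (hr : IsRep u r) {y : EucSp n} (hy : y ∈ Ω) {η₀ : USphere n} (hη₀ : η₀ ∉ irregDirAt u y) :
    ∃ U : Set (EucSp n), IsOpen U ∧ y ∈ U ∧ U ⊆ Ω ∧ ∃ V ∈ 𝓝 η₀, ∀ χ : EucSp n → ℂ,
      ContDiff ℝ ∞ χ → HasCompactSupport χ → tsupport χ ⊆ U →
        RapidlyDecreasing (fun ε => fourierOn Set.univ fun x => χ x * r ε x) V := by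
  simp only [irregDirAt, irregDir, mem_ofPred_eq, not_forall, not_not] at hη₀
  obtain ⟨φ, hφ, hφc, hφΩ, hφy, Γ, hΓ, hηΓ, w, hw, ⟨K, hK, hKΩ, hwK⟩, hrd⟩ := hη₀
  obtain ⟨d, hd, hdΓ⟩ := Metric.isOpen_iff.1 hΓ η₀ hηΓ
  have hUo : IsOpen ({x | φ x ≠ 0} ∩ (Ω : Set (EucSp n))) :=
    (isOpen_ne_fun hφ.continuous continuous_const).inter Ω.isOpen
  refine ⟨_, hUo, ⟨hφy, hy⟩, inter_subset_right, Metric.ball η₀ (d / 2),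
    Metric.ball_mem_nhds _ (by positivity), fun χ hχ hχc hχU => ?_⟩
  -- Outside `Ω` the representative `w` is arbitrary, so it is replaced by its extension by zero.
  set w' : Eps → EucSp n → ℂ := fun ε => (Ω : Set (EucSp n)).indicator (w ε) with hw'
  have hww : ∀ ε, EqOn (w' ε) (w ε) Ω := fun ε x hx => indicator_of_mem hx _
  have hw'K : ∀ ε, ∀ x ∉ K, w' ε x = 0 := fun ε x hx => by
    by_cases hxΩ : x ∈ (Ω : Set (EucSp n))
    · rw [hww ε hxΩ, hwK ε x hxΩ hx]
    · exact indicator_of_notMem hxΩ _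
  have hw'm : IsModerate (Ω : Set (EucSp n)) w' := hw.isModerate.congr Ω.isOpen hww
  have hw'c : ModCpt w' := .of_isModerate Ω.isOpen hw'm hK hKΩ hw'K
  have hrd' : RapidlyDecreasing (fun ε => fourierOn Set.univ (w' ε)) Γ := by
    refine hrd.congr (Eventually.of_forall fun ε => ?_)
    rw [← fourierOn_eq_univ (Ω := (Ω : Set (EucSp n))) fun x hx => indicator_of_notMem hx _]
    ext ξ
    exact setIntegral_congr_fun Ω.isOpen.measurableSet fun x hx => by
      simp only [indicator_of_mem hx]
  set κ : EucSp n → ℂ := fun x => χ x * (φ x)⁻¹ with hκ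
  have hκ0 : ∀ x ∉ tsupport χ, κ x = 0 := fun x hx => by
    rw [hκ]; simp only; rw [image_eq_zero_of_notMem_tsupport hx, zero_mul]
  have hκs : ContDiff ℝ ∞ κ :=
    contDiff_of_zero_off (isOpen_ne_fun hφ.continuous continuous_const) hχc.isClosed
      (fun x hx => (hχU hx).1) (hχ.contDiffOn.mul (hφ.contDiffOn.inv fun x hx => hx)) hκ0
  have hκsupp : tsupport κ ⊆ tsupport χ :=
    closure_minimal (fun x hx => by_contra fun h => hx (hκ0 x h)) (isClosed_tsupport χ)
  have hκc : HasCompactSupport κ := HasCompactSupport.intro hχc hκ0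
  have hκΩ : tsupport κ ⊆ Ω := hκsupp.trans (hχU.trans inter_subset_right)
  have hdm : IsModerate (Ω : Set (EucSp n)) fun ε x => φ x * r ε x - w' ε x :=
    (moderateNets Ω ℂ).sub_mem (smoothMul_mem Ω φ hφ hr.isModerate) hw'm
  have h1c : ModCpt fun ε x => κ x * w' ε x := ModCpt.smul hw'm hκs hκc hκΩ
  have h2c : ModCpt fun ε x => κ x * (φ x * r ε x - w' ε x) := ModCpt.smul hdm hκs hκc hκΩ
  have h1 : RapidlyDecreasing (fun ε => fourierOn Set.univ fun x => κ x * w' ε x)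
      (Metric.ball η₀ (d / 2)) := by
    obtain ⟨R, hR⟩ := hχc.isBounded.subset_ball (0 : EucSp n)
    refine rapidlyDecreasing_comp (X := Metric.ball 0 R) (f := fun _ x => x) Metric.isOpen_ball
      hχc hR hκs hκ0 (fun J => SlowBdd.of_contDiff (isCompact_closedBall 0 R)
        Metric.ball_subset_closedBall contDiff_id J) hw'c hrd' (s := fun _ => 2 / (d / 2))
      (SlowOn.const _) (Eventually.of_forall ?_)
    intro ε x _ η hη ξ hξ a b ha hb
    have e : transJac (fun x : EucSp n => x) x (η : EucSp n) = η := by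
      rw [transJac, fderiv_fun_id, ← ContinuousLinearMap.one_def, ContinuousLinearMap.adjoint_one]
      rfl
    rw [e]
    refine add_le_mul_norm_sub (norm_eq_of_mem_sphere η) (norm_eq_of_mem_sphere ξ)
      (by positivity) ?_ ha hb
    by_contra hlt
    push Not at hlt
    refine hη (hdΓ ?_)
    have h3 : dist η ξ < d / 2 := by
      rw [Subtype.dist_eq, dist_eq_norm]
      exact hlt
    have h4 : dist ξ η₀ < d / 2 := hξ
    rw [Metric.mem_ball]
    linarith [dist_triangle η ξ η₀]
  have h2 : RapidlyDecreasing (fun ε => fourierOn Set.univ fun x => κ x * (φ x * r ε x - w' ε x))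
      (Metric.ball η₀ (d / 2)) := by
    refine h2c.rapidlyDecreasing_of_negligible (fun q => ?_) _
    obtain ⟨C, hC⟩ := hw.negligible_sub (hr.smoothMul hφ) (tsupport χ) hχc
      (hχU.trans inter_subset_right) q
    obtain ⟨B, hB⟩ := hχc.exists_bound_of_continuousOn hκs.continuous.continuousOn
    refine ⟨|B| * |C|, hC.mono fun ε hε x => ?_⟩
    have hεq : (0 : ℝ) ≤ (ε : ℝ) ^ q := pow_nonneg ε.2.1.le q
    by_cases hx : x ∈ tsupport χ
    · rw [norm_mul, mul_assoc, hww ε (hχU hx).2]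
      exact mul_le_mul ((hB x hx).trans (le_abs_self B))
        ((hε x hx).trans (mul_le_mul_of_nonneg_right (le_abs_self C) hεq)) (norm_nonneg _)
        (abs_nonneg _)
    · rw [hκ0 x hx, zero_mul, norm_zero]
      positivity
  refine (h1.fourierOn_add h2 h1c h2c).congr (Eventually.of_forall fun ε => ?_)
  congr 1
  ext x
  rw [← mul_add, add_sub_cancel, ← mul_assoc]
  congr 1
  by_cases hx : x ∈ tsupport χ
  · rw [hκ]
    simp only
    rw [mul_assoc, inv_mul_cancel₀ (hχU hx).1, mul_one]
  · rw [hκ0 x hx, zero_mul, image_eq_zero_of_notMem_tsupport hx]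

end Localization

/-! ### Points at which the pullback is locally constant -/

section Constant

variable {n m : ℕ} {Ω₁ : TopologicalSpace.Opens (EucSp n)} {Ω₂ : TopologicalSpace.Opens (EucSp m)}

/-- Where the generalized graph of `f` avoids the support of `u - k`, the pullback differs from `k`
by a negligible net. -/
lemma exists_negligible_sub_const {g : Colombeau Ω₁ (EucSp m)} {f : Eps → EucSp n → EucSp m}
    (hf : IsCBoundedRep Ω₂ g f) {u : Colombeau Ω₂ ℂ} {r : Eps → EucSp m → ℂ} (hr : IsRep u r)
    {x₀ : EucSp n} (hx₀ : x₀ ∈ Ω₁) (hK : x₀ ∉ nonconstSet Ω₁ f u) :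
    ∃ k ∈ moderateNumbers, ∃ X ∈ 𝓝 x₀, ∀ q : ℕ, ∃ C : ℝ, ∀ᶠ ε in toZero, ∀ x ∈ X,
      ‖r ε (f ε x) - k ε‖ ≤ C * (ε : ℝ) ^ q := by
  simp only [nonconstSet, mem_iInter, not_forall] at hK
  obtain ⟨k', hk'⟩ := hK
  obtain ⟨k, rfl⟩ := QuotientAddGroup.mk_surjective k'
  have hrk : IsRep (u - constFun Ω₂ (k : GenNumber)) fun ε x => r ε x - (k : Eps → ℂ) ε := by
    obtain ⟨h, rfl⟩ := hr
    exact ⟨(moderateNets Ω₂ ℂ).sub_mem h (constNet_mem Ω₂ k.2), rfl⟩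
  obtain ⟨K₀, hK₀, hxK₀, hK₀Ω⟩ := exists_compact_subset Ω₁.isOpen hx₀
  obtain ⟨K', hK'c, hK'Ω, hKK'⟩ := hf.2 K₀ hK₀ hK₀Ω
  have key : ∃ X ∈ 𝓝 x₀, ∀ q : ℕ, ∃ C : ℝ, ∀ᶠ ε in toZero, ∀ x ∈ X, x ∈ Ω₁ → f ε x ∈ K' →
      ‖r ε (f ε x) - (k : Eps → ℂ) ε‖ ≤ C * (ε : ℝ) ^ q := by
    refine hK'c.induction_on (p := fun T => ∃ X ∈ 𝓝 x₀, ∀ q : ℕ, ∃ C : ℝ, ∀ᶠ ε in toZero,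
      ∀ x ∈ X, x ∈ Ω₁ → f ε x ∈ T → ‖r ε (f ε x) - (k : Eps → ℂ) ε‖ ≤ C * (ε : ℝ) ^ q)
      ?_ ?_ ?_ ?_
    · exact ⟨univ, univ_mem, fun q => ⟨0, Eventually.of_forall fun ε x _ _ h => h.elim⟩⟩
    · rintro S T hST ⟨X, hX, h⟩
      refine ⟨X, hX, fun q => ?_⟩
      obtain ⟨C, hC⟩ := h q
      exact ⟨C, hC.mono fun ε hε x hx hxΩ hxS => hε x hx hxΩ (hST hxS)⟩
    · rintro S T ⟨X, hX, h⟩ ⟨Y, hY, h'⟩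
      refine ⟨X ∩ Y, inter_mem hX hY, fun q => ?_⟩
      obtain ⟨C, hC⟩ := h q
      obtain ⟨D, hD⟩ := h' q
      refine ⟨max C D, ?_⟩
      filter_upwards [hC, hD] with ε h1 h2 x hx hxΩ hxS
      have hεq : (0 : ℝ) ≤ (ε : ℝ) ^ q := pow_nonneg ε.2.1.le q
      rcases hxS with hxS | hxS
      · exact (h1 x hx.1 hxΩ hxS).trans (mul_le_mul_of_nonneg_right (le_max_left _ _) hεq)
      · exact (h2 x hx.2 hxΩ hxS).trans (mul_le_mul_of_nonneg_right (le_max_right _ _) hεq)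
    · intro y hy
      by_cases hgr : (x₀, y) ∈ genGraph (Ω₁ : Set (EucSp n)) Ω₂ f
      · have hys : y ∉ gsupp (u - constFun Ω₂ (k : GenNumber)) := fun h =>
          hk' ⟨(x₀, y), ⟨hgr, hx₀, h⟩, rfl⟩
        simp only [gsupp, mem_ofPred_eq, not_and, not_not] at hys
        obtain ⟨W, hW, hyW, hWΩ, s, hs, hsn⟩ := hys (hK'Ω hy)
        obtain ⟨T, hT, hyT, hTW⟩ := exists_compact_subset hW hyW
        have hn : IsNegligible W fun ε x => r ε x - (k : Eps → ℂ) ε := by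
          simpa using ((hs.negligible_sub hrk).mono hWΩ).add hsn
        refine ⟨T, mem_nhdsWithin_of_mem_nhds (mem_interior_iff_mem_nhds.1 hyT), univ, univ_mem,
          fun q => ?_⟩
        obtain ⟨C, hC⟩ := hn T hT hTW q
        exact ⟨C, hC.mono fun ε hε x _ _ hx => hε _ hx⟩
      · obtain ⟨U, hU, W, hW, h⟩ := eventually_notMem_of_notMem_genGraph hx₀ (hK'Ω hy) hgr
        exact ⟨W, mem_nhdsWithin_of_mem_nhds hW, U, hU, fun q => ⟨0, h.mono
          fun ε hε x hx hxΩ hxW => (hε x hx hxΩ hxW).elim⟩⟩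
  obtain ⟨X, hX, h⟩ := key
  refine ⟨k, k.2, X ∩ interior K₀, inter_mem hX (isOpen_interior.mem_nhds hxK₀), fun q => ?_⟩
  obtain ⟨C, hC⟩ := h q
  exact ⟨C, hC.mono fun ε hε x hx =>
    hε x hx.1 (hK₀Ω (interior_subset hx.2)) (hKK' ε (interior_subset hx.2))⟩

lemma rapidlyDecreasing_const_mul {k : Eps → ℂ} (hk : k ∈ moderateNumbers) {ψ : EucSp n → ℂ}
    (hψ : ContDiff ℝ ∞ ψ) (hψc : HasCompactSupport ψ) (Ξ : Set (USphere n)) :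
    RapidlyDecreasing (fun ε => fourierOn Set.univ fun x => k ε * ψ x) Ξ := by
  have hψm : ModCpt fun _ : Eps => ψ := by
    refine ⟨fun _ => hψ, ⟨tsupport ψ, hψc, fun _ x hx => image_eq_zero_of_notMem_tsupport hx⟩,
      fun j => ?_⟩
    obtain ⟨B, hB⟩ := hψc.exists_bound_of_continuousOn (f := iteratedFDeriv ℝ j ψ)
      (hψ.continuous_iteratedFDeriv (by exact_mod_cast le_top)).continuousOn
    refine ⟨0, |B|, Eventually.of_forall fun _ x => ?_⟩
    rw [pow_zero, mul_one]
    by_cases hx : x ∈ tsupport ψ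
    · exact (hB x hx).trans (le_abs_self B)
    · rw [iteratedFDeriv_zero_off hψc.isClosed (fun x hx => image_eq_zero_of_notMem_tsupport hx)
        j x hx, norm_zero]
      exact abs_nonneg _
  obtain ⟨N, C, hC⟩ := hk
  refine rapidlyDecreasing_iff.2 ⟨N, fun p => ?_⟩
  obtain ⟨M, D, hD0, hD⟩ := hψm.fourier_decay p
  -- The function `ψ` does not depend on `ε`, so one fixed value of `ε` provides a bound.
  obtain ⟨ε₁, h1⟩ := hD.exists
  have hε₁ : (0 : ℝ) ≤ (ε₁ : ℝ)⁻¹ ^ M := pow_nonneg (inv_nonneg.2 ε₁.2.1.le) _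
  refine ⟨|C| * (D * (ε₁ : ℝ)⁻¹ ^ M), by positivity, hC.mono fun ε hε t ht ξ _ => ?_⟩
  have e1 := h1 (t • (ξ : EucSp n))
  rw [norm_smul, Real.norm_of_nonneg ht.le, norm_eq_of_mem_sphere, mul_one] at e1
  have e2 : 𝓕 (fun x => k ε * ψ x) (t • (ξ : EucSp n)) = k ε * 𝓕 ψ (t • (ξ : EucSp n)) := by
    rw [Real.fourier_eq', Real.fourier_eq', ← integral_const_mul]
    refine integral_congr_ae (Eventually.of_forall fun x => ?_)
    simp only [smul_eq_mul]
    ring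
  rw [e2, norm_mul]
  have e3 := hε.trans (mul_pow_inv_le (le_refl N))
  calc _ = ‖k ε‖ * ((1 + t) ^ p * ‖𝓕 ψ (t • (ξ : EucSp n))‖) := by ring
    _ ≤ (|C| * (ε : ℝ)⁻¹ ^ N) * (D * (ε₁ : ℝ)⁻¹ ^ M) :=
      mul_le_mul e3 e1 (by positivity) ((norm_nonneg _).trans e3)
    _ = _ := by ring

lemma notMem_WF_of_notMem_nonconstSet {g : Colombeau Ω₁ (EucSp m)} {f : Eps → EucSp n → EucSp m}
    (hf : IsCBoundedRep Ω₂ g f) {u : Colombeau Ω₂ ℂ} {v : Colombeau Ω₁ ℂ}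
    (hv : IsPullback g u v) {x₀ : EucSp n} (hx₀ : x₀ ∈ Ω₁) (hK : x₀ ∉ nonconstSet Ω₁ f u)
    (ξ : USphere n) : (x₀, ξ) ∉ WF v := by
  obtain ⟨r, hr⟩ := exists_isRep u
  obtain ⟨k, hk, X, hX, hn⟩ := exists_negligible_sub_const hf hr hx₀ hK
  obtain ⟨ψ, hψ, hψc, hψs, hψ1⟩ := exists_cutoff (inter_mem hX (Ω₁.isOpen.mem_nhds hx₀))
  have hψΩ : tsupport ψ ⊆ Ω₁ := hψs.trans inter_subset_right
  have hvr := hv f r hf hr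
  refine notMem_WF hvr hψ hψc hψΩ (by rw [hψ1.self_of_nhds]; exact one_ne_zero)
    (Ξ := univ) univ_mem ?_
  have h1m : ModCpt fun ε x => ψ x * (r ε (f ε x) - k ε) :=
    ModCpt.smul ((moderateNets Ω₁ ℂ).sub_mem hvr.isModerate (constNet_mem Ω₁ hk)) hψ hψc hψΩ
  have h2m : ModCpt fun ε x => k ε * ψ x := by
    simpa only [mul_comm] using ModCpt.smul (constNet_mem Ω₁ hk) hψ hψc hψΩ
  have h1 : RapidlyDecreasing (fun ε => fourierOn Set.univ fun x => ψ x * (r ε (f ε x) - k ε))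
      univ := by
    refine h1m.rapidlyDecreasing_of_negligible (fun q => ?_) _
    obtain ⟨C, hC⟩ := hn q
    obtain ⟨B, hB⟩ := hψc.exists_bound_of_continuousOn hψ.continuous.continuousOn
    refine ⟨|B| * |C|, hC.mono fun ε hε x => ?_⟩
    have hεq : (0 : ℝ) ≤ (ε : ℝ) ^ q := pow_nonneg ε.2.1.le q
    by_cases hx : x ∈ tsupport ψ
    · rw [norm_mul, mul_assoc]
      exact mul_le_mul ((hB x hx).trans (le_abs_self B))
        ((hε x (hψs hx).1).trans (mul_le_mul_of_nonneg_right (le_abs_self C) hεq)) (norm_nonneg _)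
        (abs_nonneg _)
    · rw [image_eq_zero_of_notMem_tsupport hx, zero_mul, norm_zero]
      positivity
  refine (h1.fourierOn_add (rapidlyDecreasing_const_mul hk hψ hψc univ) h1m h2m).congr
    (Eventually.of_forall fun ε => ?_)
  congr 1
  ext x
  ring

end Constant

/-! ### Microlocal analysis at slow scaled points -/

section Microlocal

variable {n m : ℕ} {Ω₁ : TopologicalSpace.Opens (EucSp n)} {Ω₂ : TopologicalSpace.Opens (EucSp m)}

lemma exists_slowBdd_of_mem_slowSet {g : Colombeau Ω₁ (EucSp m)} {f : Eps → EucSp n → EucSp m}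
    (hf : IsCBoundedRep Ω₂ g f) {x₀ : EucSp n} (hx₀ : x₀ ∈ slowSet Ω₁ f) :
    ∃ X : Set (EucSp n), IsOpen X ∧ x₀ ∈ X ∧ X ⊆ Ω₁ ∧ ∀ J, SlowBdd toZero id X J f := by
  obtain ⟨_, X, hX, hXΩ, h⟩ := hx₀
  refine ⟨interior X, isOpen_interior, mem_interior_iff_mem_nhds.2 hX,
    interior_subset.trans hXΩ, fun J => ⟨Eventually.of_forall fun ε =>
      (hf.1.isModerate.1 ε).mono (interior_subset.trans hXΩ), fun j _ => ?_⟩⟩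
  obtain ⟨s, C, hs, hb⟩ := h j
  exact ⟨fun ε => C * s ε, (SlowOn.const C).mul hs.slowOn,
    hb.mono fun ε hε x hx => hε x (interior_subset hx)⟩

/-- If `(x₀, η₀)` lies in `D_f` and `ξ₀` is not a limit of the directions of `ᵗdf_ε(x)η`, then the
phases with frequencies in directions near `η₀` and `ξ₀` have no stationary points near `x₀`,
uniformly up to a slow scaled factor. -/
lemma exists_nonstationary {f : Eps → EucSp n → EucSp m} {x₀ : EucSp n} {η₀ : USphere m}
    {ξ₀ : USphere n} (hD : (x₀, η₀) ∈ domSet Ω₁ f)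
    (hξ₀ : ((x₀, η₀), (ξ₀ : EucSp n)) ∉
      genGraph (domSet Ω₁ f) (Metric.sphere (0 : EucSp n) 1) (normJac f)) :
    ∃ X ∈ 𝓝 x₀, ∃ V ∈ 𝓝 η₀, ∃ Ξ ∈ 𝓝 ξ₀, ∃ s : Eps → ℝ, SlowOn toZero id s ∧
      ∀ᶠ ε in toZero, ∀ x ∈ X, ∀ η ∈ V, ∀ ξ ∈ Ξ, ∀ a b : ℝ, 0 ≤ a → 0 ≤ b →
        a + b ≤ s ε * ‖a • transJac (f ε) x (η : EucSp m) - b • (ξ : EucSp n)‖ := by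
  obtain ⟨U, hU, W, hW, hUW⟩ := eventually_notMem_of_notMem_genGraph hD ξ₀.2 hξ₀
  obtain ⟨-, X, hX, hXΩ, V, hV, σ, hσ0, hσ, α, β, hα, hβ, hest⟩ := hD
  have hdom : ∀ x ∈ interior X, ∀ η ∈ interior V, (x, η) ∈ domSet Ω₁ f := fun x hx η hη =>
    ⟨hXΩ (interior_subset hx), X, mem_interior_iff_mem_nhds.1 hx, hXΩ, V,
      mem_interior_iff_mem_nhds.1 hη, σ, hσ0, hσ, α, β, hα, hβ, hest⟩
  obtain ⟨X', hX', V', hV', hXV⟩ := mem_nhds_prod_iff.1 hU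
  obtain ⟨d, hd, hdW⟩ := Metric.mem_nhds_iff.1 hW
  refine ⟨X' ∩ interior X, inter_mem hX' (interior_mem_nhds.2 hX), V' ∩ interior V,
    inter_mem hV' (interior_mem_nhds.2 hV), Metric.ball ξ₀ (d / 2),
    Metric.ball_mem_nhds _ (by positivity), fun ε => (σ ε * α⁻¹ + 1) * (2 / (d / 2)),
    ((hσ.slowOn.mul (SlowOn.const _)).add (SlowOn.const _)).mul (SlowOn.const _), ?_⟩
  filter_upwards [hUW, hest] with ε h1 h2 x hx η hη ξ hξ a b ha hb
  have e1 := h1 (x, η) (hXV ⟨hx.1, hη.1⟩) (hdom x hx.2 η hη.2)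
  have e2 := h2.1 x (interior_subset hx.2) η (interior_subset hη.2)
  set T := transJac (f ε) x (η : EucSp m) with hT
  have hσε := hσ0 ε
  rw [norm_smul, Real.norm_of_nonneg hσε.le] at e2
  have hT0 : 0 < ‖T‖ := by
    by_contra h
    have : ‖T‖ = 0 := le_antisymm (not_lt.1 h) (norm_nonneg _)
    rw [this, mul_zero] at e2
    linarith
  have hv : ‖‖T‖⁻¹ • T‖ = 1 := by
    rw [norm_smul, norm_inv, norm_norm, inv_mul_cancel₀ hT0.ne']
  have hdist : d / 2 ≤ ‖‖T‖⁻¹ • T - (ξ : EucSp n)‖ := by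
    by_contra hlt
    push Not at hlt
    refine e1 (hdW ?_)
    have h3 : dist (‖T‖⁻¹ • T) (ξ : EucSp n) < d / 2 := by rwa [dist_eq_norm]
    have h4 : dist (ξ : EucSp n) ξ₀ < d / 2 := hξ
    rw [Metric.mem_ball]
    change dist (‖T‖⁻¹ • T) (ξ₀ : EucSp n) < d
    exact (dist_triangle _ (ξ : EucSp n) _).trans_lt (by linarith)
  have h5 := add_le_mul_norm_sub hv (norm_eq_of_mem_sphere ξ) (by positivity) hdist
    (mul_nonneg ha hT0.le) hb
  have h6 : (a * ‖T‖) • ‖T‖⁻¹ • T = a • T := by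
    rw [smul_smul, mul_assoc, mul_inv_cancel₀ hT0.ne', mul_one]
  rw [h6] at h5
  have h7 : a ≤ σ ε * α⁻¹ * (a * ‖T‖) := by
    have : 1 ≤ σ ε * ‖T‖ * α⁻¹ := by
      rw [← div_eq_mul_inv, one_le_div hα]
      exact e2
    calc a = a * 1 := (mul_one a).symm
      _ ≤ a * (σ ε * ‖T‖ * α⁻¹) := mul_le_mul_of_nonneg_left this ha
      _ = _ := by ring
  have h8 : 0 ≤ σ ε * α⁻¹ := by positivity
  have h9 : 0 ≤ a * ‖T‖ := by positivity
  calc a + b ≤ (σ ε * α⁻¹ + 1) * (a * ‖T‖ + b) := by nlinarith [mul_nonneg h8 hb]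
    _ ≤ (σ ε * α⁻¹ + 1) * (2 / (d / 2) * ‖a • T - b • (ξ : EucSp n)‖) :=
      mul_le_mul_of_nonneg_left h5 (by linarith)
    _ = _ := by ring

/-- The contribution of a cutoff of `u` near a point `y` of the generalized graph over `x₀`. The
directions `η` are distributed, by compactness of the sphere, over the irregular ones, which lead
to non-stationary phases, and the regular ones. -/
lemma exists_rapidlyDecreasing_of_mem_genGraph {f : Eps → EucSp n → EucSp m} {X₀ : Set (EucSp n)}
    (hX₀ : IsOpen X₀) {x₀ : EucSp n} (hx₀ : x₀ ∈ X₀)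
    (hf : ∀ J, SlowBdd toZero id X₀ J f) {u : Colombeau Ω₂ ℂ} {r : Eps → EucSp m → ℂ}
    (hr : IsRep u r) {y : EucSp m} (hy : y ∈ Ω₂) {ξ₀ : USphere n}
    (hirr : ∀ η ∈ irregDirAt u y, (x₀, η) ∈ domSet Ω₁ f ∧ ((x₀, η), (ξ₀ : EucSp n)) ∉
      genGraph (domSet Ω₁ f) (Metric.sphere (0 : EucSp n) 1) (normJac f)) :
    ∃ X ∈ 𝓝 x₀, ∃ Ξ ∈ 𝓝 ξ₀, ∃ U ∈ 𝓝 y, ∀ χ : EucSp m → ℂ, ContDiff ℝ ∞ χ →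
      HasCompactSupport χ → tsupport χ ⊆ U → ∀ ψ : EucSp n → ℂ, ContDiff ℝ ∞ ψ →
      HasCompactSupport ψ → tsupport ψ ⊆ X →
      RapidlyDecreasing (fun ε => fourierOn Set.univ fun x => ψ x * (χ (f ε x) * r ε (f ε x))) Ξ := by
  have key : ∃ (Γ : Set (USphere m)), ∃ X ∈ 𝓝 x₀, ∃ Ξ ∈ 𝓝 ξ₀, ∃ U ∈ 𝓝 y, ∃ s : Eps → ℝ,
      SlowOn toZero id s ∧ (∀ᶠ ε in toZero, ∀ x ∈ X, ∀ η ∈ (univ : Set (USphere m)), η ∉ Γ →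
        ∀ ξ ∈ Ξ, ∀ a b : ℝ, 0 ≤ a → 0 ≤ b →
          a + b ≤ s ε * ‖a • transJac (f ε) x (η : EucSp m) - b • (ξ : EucSp n)‖) ∧
      ∀ χ : EucSp m → ℂ, ContDiff ℝ ∞ χ → HasCompactSupport χ → tsupport χ ⊆ U →
        RapidlyDecreasing (fun ε => fourierOn Set.univ fun x => χ x * r ε x) Γ := by
    refine isCompact_univ.induction_on (p := fun S => ∃ (Γ : Set (USphere m)), ∃ X ∈ 𝓝 x₀,
      ∃ Ξ ∈ 𝓝 ξ₀, ∃ U ∈ 𝓝 y, ∃ s : Eps → ℝ,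
      SlowOn toZero id s ∧ (∀ᶠ ε in toZero, ∀ x ∈ X, ∀ η ∈ S, η ∉ Γ →
        ∀ ξ ∈ Ξ, ∀ a b : ℝ, 0 ≤ a → 0 ≤ b →
          a + b ≤ s ε * ‖a • transJac (f ε) x (η : EucSp m) - b • (ξ : EucSp n)‖) ∧
      ∀ χ : EucSp m → ℂ, ContDiff ℝ ∞ χ → HasCompactSupport χ → tsupport χ ⊆ U →
        RapidlyDecreasing (fun ε => fourierOn Set.univ fun x => χ x * r ε x) Γ) ?_ ?_ ?_ ?_
    · exact ⟨∅, univ, univ_mem, univ, univ_mem, univ, univ_mem, fun _ => 0, SlowOn.const 0,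
        Eventually.of_forall fun _ _ _ _ h => h.elim, fun _ _ _ _ =>
          ⟨0, fun _ => ⟨0, Eventually.of_forall fun _ _ _ _ h => h.elim⟩⟩⟩
    · rintro S T hST ⟨Γ, X, hX, Ξ, hΞ, U, hU, s, hs, h1, h2⟩
      exact ⟨Γ, X, hX, Ξ, hΞ, U, hU, s, hs,
        h1.mono fun ε hε x hx η hη => hε x hx η (hST hη), h2⟩
    · rintro S T ⟨Γ, X, hX, Ξ, hΞ, U, hU, s, hs, h1, h2⟩ ⟨Γ', X', hX', Ξ', hΞ', U', hU', s', hs',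
        h1', h2'⟩
      refine ⟨Γ ∪ Γ', X ∩ X', inter_mem hX hX', Ξ ∩ Ξ', inter_mem hΞ hΞ', U ∩ U',
        inter_mem hU hU', fun ε => |s ε| + |s' ε|, hs.abs.add hs'.abs, ?_, ?_⟩
      · filter_upwards [h1, h1'] with ε h1 h1' x hx η hη hηΓ ξ hξ a b ha hb
        rcases hη with hη | hη
        · refine (h1 x hx.1 η hη (fun h => hηΓ (Or.inl h)) ξ hξ.1 a b ha hb).trans
            (mul_le_mul_of_nonneg_right ?_ (norm_nonneg _))
          linarith [le_abs_self (s ε), abs_nonneg (s' ε)]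
        · refine (h1' x hx.2 η hη (fun h => hηΓ (Or.inr h)) ξ hξ.2 a b ha hb).trans
            (mul_le_mul_of_nonneg_right ?_ (norm_nonneg _))
          linarith [le_abs_self (s' ε), abs_nonneg (s ε)]
      · intro χ hχ hχc hχU
        exact (h2 χ hχ hχc (hχU.trans inter_subset_left)).union
          (h2' χ hχ hχc (hχU.trans inter_subset_right))
    · intro η _
      by_cases hη : η ∈ irregDirAt u y
      · obtain ⟨X, hX, V, hV, Ξ, hΞ, s, hs, h⟩ := exists_nonstationary (hirr η hη).1 (hirr η hη).2
        exact ⟨V, mem_nhdsWithin_of_mem_nhds hV, ∅, X, hX, Ξ, hΞ, univ, univ_mem, s, hs,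
          h.mono fun ε hε x hx η hη _ => hε x hx η hη, fun _ _ _ _ =>
          ⟨0, fun _ => ⟨0, Eventually.of_forall fun _ _ _ _ h => h.elim⟩⟩⟩
      · obtain ⟨U, hU, hyU, -, V, hV, h⟩ := exists_rapidlyDecreasing_cutoff hr hy hη
        exact ⟨V, mem_nhdsWithin_of_mem_nhds hV, V, univ, univ_mem, univ, univ_mem, U,
          hU.mem_nhds hyU, fun _ => 0, SlowOn.const 0,
          Eventually.of_forall fun _ _ _ _ h h' => (h' h).elim, h⟩
  obtain ⟨Γ, X, hX, Ξ, hΞ, U, hU, s, hs, h1, h2⟩ := key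
  refine ⟨interior X ∩ X₀, inter_mem (interior_mem_nhds.2 hX) (hX₀.mem_nhds hx₀), Ξ, hΞ, U ∩ Ω₂,
    inter_mem hU (Ω₂.isOpen.mem_nhds hy), fun χ hχ hχc hχU ψ hψ hψc hψX => ?_⟩
  refine rapidlyDecreasing_comp (isOpen_interior.inter hX₀) hψc hψX hψ
    (fun x hx => image_eq_zero_of_notMem_tsupport hx) (fun J => ⟨?_, fun j hj => ?_⟩)
    (ModCpt.smul hr.isModerate hχ hχc (hχU.trans inter_subset_right))
    (h2 χ hχ hχc (hχU.trans inter_subset_left)) hs ?_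
  · exact (hf J).smooth.mono fun ε hε => hε.mono inter_subset_right
  · obtain ⟨t, ht, hb⟩ := (hf J).bound j hj
    exact ⟨t, ht, hb.mono fun ε hε x hx => hε x hx.2⟩
  · exact h1.mono fun ε hε x hx η hη => hε x (interior_subset hx.1) η (mem_univ _) hη

/-- Compactness of the fibre of the generalized graph over `x₀` reduces the claim to cutoffs of `u`
with small supports. -/
lemma notMem_WF_of_mem_slowSet {g : Colombeau Ω₁ (EucSp m)} {f : Eps → EucSp n → EucSp m}
    (hf : IsCBoundedRep Ω₂ g f) {u : Colombeau Ω₂ ℂ} {v : Colombeau Ω₁ ℂ}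
    (hv : IsPullback g u v) {x₀ : EucSp n} (hx₀ : x₀ ∈ slowSet Ω₁ f) {ξ₀ : USphere n}
    (hirr : ∀ y η, (x₀, y) ∈ genGraph (Ω₁ : Set (EucSp n)) Ω₂ f → (y, η) ∈ WF u →
      (x₀, η) ∈ domSet Ω₁ f ∧ ((x₀, η), (ξ₀ : EucSp n)) ∉
        genGraph (domSet Ω₁ f) (Metric.sphere (0 : EucSp n) 1) (normJac f)) :
    (x₀, ξ₀) ∉ WF v := by
  obtain ⟨r, hr⟩ := exists_isRep u
  obtain ⟨X₀, hX₀, hxX₀, hX₀Ω, hfs⟩ := exists_slowBdd_of_mem_slowSet hf hx₀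
  have hxΩ : x₀ ∈ Ω₁ := hX₀Ω hxX₀
  obtain ⟨K₀, hK₀, hxK₀, hK₀Ω⟩ := exists_compact_subset Ω₁.isOpen hxΩ
  obtain ⟨K', hK'c, hK'Ω, hKK'⟩ := hf.2 K₀ hK₀ hK₀Ω
  have hmod : ∀ (ρ : EucSp m → ℂ), ContDiff ℝ ∞ ρ → ∀ ψ : EucSp n → ℂ, ContDiff ℝ ∞ ψ →
      HasCompactSupport ψ → tsupport ψ ⊆ Ω₁ →
      ModCpt fun ε x => ψ x * (ρ (f ε x) * r ε (f ε x)) := fun ρ hρ ψ hψ hψc hψΩ =>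
    ModCpt.smul (hf.isModerate_comp (smoothMul_mem Ω₂ ρ hρ hr.isModerate)) hψ hψc hψΩ
  have key : ∃ X ∈ 𝓝 x₀, ∃ Ξ ∈ 𝓝 ξ₀, ∃ χ : EucSp m → ℂ, ContDiff ℝ ∞ χ ∧
      (∀ y ∈ K', χ y = 1) ∧ ∀ ρ : EucSp m → ℂ, ContDiff ℝ ∞ ρ → ∀ ψ : EucSp n → ℂ,
      ContDiff ℝ ∞ ψ → HasCompactSupport ψ → tsupport ψ ⊆ X → tsupport ψ ⊆ Ω₁ →
      RapidlyDecreasing (fun ε => fourierOn Set.univ fun x =>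
        ψ x * ((ρ (f ε x) * χ (f ε x)) * r ε (f ε x))) Ξ := by
    refine hK'c.induction_on (p := fun T => ∃ X ∈ 𝓝 x₀, ∃ Ξ ∈ 𝓝 ξ₀, ∃ χ : EucSp m → ℂ,
      ContDiff ℝ ∞ χ ∧ (∀ y ∈ T, χ y = 1) ∧ ∀ ρ : EucSp m → ℂ, ContDiff ℝ ∞ ρ →
      ∀ ψ : EucSp n → ℂ, ContDiff ℝ ∞ ψ → HasCompactSupport ψ → tsupport ψ ⊆ X →
      tsupport ψ ⊆ Ω₁ → RapidlyDecreasing (fun ε => fourierOn Set.univ fun x =>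
        ψ x * ((ρ (f ε x) * χ (f ε x)) * r ε (f ε x))) Ξ) ?_ ?_ ?_ ?_
    · refine ⟨univ, univ_mem, univ, univ_mem, fun _ => 0, contDiff_const, fun _ h => h.elim,
        fun _ _ _ _ _ _ _ => RapidlyDecreasing.of_eventually_zero
          (Eventually.of_forall fun ε x => ?_) _⟩
      ring
    · rintro S T hST ⟨X, hX, Ξ, hΞ, χ, hχ, hχ1, h⟩
      exact ⟨X, hX, Ξ, hΞ, χ, hχ, fun y hy => hχ1 y (hST hy), h⟩
    · rintro S T ⟨X, hX, Ξ, hΞ, χ, hχ, hχ1, h⟩ ⟨X', hX', Ξ', hΞ', χ', hχ', hχ1', h'⟩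
      refine ⟨X ∩ X', inter_mem hX hX', Ξ ∩ Ξ', inter_mem hΞ hΞ',
        -- `1 - (1 - χ)(1 - χ')` equals `1` wherever one of the two cutoffs does.
        fun y => χ y + (1 - χ y) * χ' y, hχ.add ((contDiff_const.sub hχ).mul hχ'), ?_, ?_⟩
      · rintro y (hy | hy)
        · simp only [hχ1 y hy]; ring
        · simp only [hχ1' y hy]; ring
      · intro ρ hρ ψ hψ hψc hψX hψΩ
        have hρ' : ContDiff ℝ ∞ fun y => ρ y * (1 - χ y) := hρ.mul (contDiff_const.sub hχ)
        have h1 := (h ρ hρ ψ hψ hψc (hψX.trans inter_subset_left) hψΩ).mono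
          (inter_subset_left : Ξ ∩ Ξ' ⊆ Ξ)
        have h2 := (h' _ hρ' ψ hψ hψc (hψX.trans inter_subset_right) hψΩ).mono
          (inter_subset_right : Ξ ∩ Ξ' ⊆ Ξ')
        refine (h1.fourierOn_add h2 (hmod _ (hρ.mul hχ) ψ hψ hψc hψΩ)
          (hmod _ (hρ'.mul hχ') ψ hψ hψc hψΩ)).congr (Eventually.of_forall fun ε => ?_)
        congr 1
        ext x
        ring
    · intro y hy
      by_cases hgr : (x₀, y) ∈ genGraph (Ω₁ : Set (EucSp n)) Ω₂ f
      · obtain ⟨X, hX, Ξ, hΞ, U, hU, h⟩ := exists_rapidlyDecreasing_of_mem_genGraph (Ω₁ := Ω₁)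
          hX₀ hxX₀ hfs hr (hK'Ω hy) fun η hη => hirr y η hgr ⟨hK'Ω hy, hη⟩
        obtain ⟨χ, hχ, hχc, hχU, hχ1⟩ := exists_cutoff hU
        refine ⟨{z | χ z = 1}, mem_nhdsWithin_of_mem_nhds hχ1, X, hX, Ξ, hΞ, χ, hχ,
          fun z hz => hz, fun ρ hρ ψ hψ hψc hψX _ => ?_⟩
        exact h (fun z => ρ z * χ z) (hρ.mul hχ) hχc.mul_left
          ((tsupport_mul_subset_right).trans hχU) ψ hψ hψc hψX
      · obtain ⟨X, hX, W, hW, h⟩ := eventually_notMem_of_notMem_genGraph hxΩ (hK'Ω hy) hgr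
        obtain ⟨χ, hχ, hχc, hχW, hχ1⟩ := exists_cutoff hW
        refine ⟨{z | χ z = 1}, mem_nhdsWithin_of_mem_nhds hχ1, X, hX, univ, univ_mem, χ, hχ,
          fun z hz => hz, fun ρ hρ ψ hψ hψc hψX hψΩ =>
            RapidlyDecreasing.of_eventually_zero (h.mono fun ε hε x => ?_) _⟩
        by_cases hx : x ∈ tsupport ψ
        · rw [image_eq_zero_of_notMem_tsupport fun hx' => hε x (hψX hx) (hψΩ hx) (hχW hx')]
          ring
        · rw [image_eq_zero_of_notMem_tsupport hx, zero_mul]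
  obtain ⟨X, hX, Ξ, hΞ, χ, hχ, hχ1, h⟩ := key
  obtain ⟨ψ, hψ, hψc, hψs, hψ1⟩ := exists_cutoff (inter_mem hX (isOpen_interior.mem_nhds hxK₀))
  have hψK : tsupport ψ ⊆ K₀ := hψs.trans (inter_subset_right.trans interior_subset)
  have hψΩ : tsupport ψ ⊆ Ω₁ := hψK.trans hK₀Ω
  refine notMem_WF (hv f r hf hr) hψ hψc hψΩ (by rw [hψ1.self_of_nhds]; exact one_ne_zero) hΞ ?_
  refine (h (fun _ => 1) contDiff_const ψ hψ hψc (hψs.trans inter_subset_left) hψΩ).congr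
    (Eventually.of_forall fun ε => ?_)
  congr 1
  ext x
  by_cases hx : x ∈ tsupport ψ
  · rw [hχ1 _ (hKK' ε (hψK hx)), one_mul, one_mul]
  · rw [image_eq_zero_of_notMem_tsupport hx, zero_mul, zero_mul]

end Microlocal

end ColombeauWF

theorem mainTheorem1 {n m : ℕ} (Ω₁ : TopologicalSpace.Opens (ColombeauWF.EucSp n))
    (Ω₂ : TopologicalSpace.Opens (ColombeauWF.EucSp m))
    (g : ColombeauWF.Colombeau Ω₁ (ColombeauWF.EucSp m))
    (f : ColombeauWF.Eps → ColombeauWF.EucSp n → ColombeauWF.EucSp m)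
    (hf : ColombeauWF.IsCBoundedRep Ω₂ g f)
    (u : ColombeauWF.Colombeau Ω₂ ℂ) :
    (∃! v : ColombeauWF.Colombeau Ω₁ ℂ, ColombeauWF.IsPullback g u v) ∧
    ∀ v : ColombeauWF.Colombeau Ω₁ ℂ, ColombeauWF.IsPullback g u v →
      ColombeauWF.WF v ⊆
        ColombeauWF.pullSet Ω₁ Ω₂ f (ColombeauWF.WF u) ∪
        ColombeauWF.unfavSupp Ω₁ Ω₂ f (ColombeauWF.WF u) ×ˢ Set.univ ∪
        (ColombeauWF.nonconstSet Ω₁ f u ∩ (ColombeauWF.slowSet Ω₁ f)ᶜ) ×ˢ Set.univ := by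
  refine ⟨ColombeauWF.existsUnique_isPullback hf u, fun v hv => ?_⟩
  rintro ⟨x₀, ξ₀⟩ hWF
  by_contra hcon
  simp only [mem_union, mem_prod, mem_univ, and_true, not_or] at hcon
  obtain ⟨⟨hpull, hunf⟩, hns⟩ := hcon
  by_cases hK : x₀ ∈ ColombeauWF.nonconstSet Ω₁ f u
  · have hS : x₀ ∈ ColombeauWF.slowSet Ω₁ f := by_contra fun h => hns ⟨hK, h⟩
    refine ColombeauWF.notMem_WF_of_mem_slowSet hf hv hS (fun y η hgr hη => ?_) hWF
    have hD : (x₀, η) ∈ ColombeauWF.domSet Ω₁ f :=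
      by_contra fun h => hunf ⟨y, η, hgr, h, hη⟩
    exact ⟨hD, fun hM => hpull ⟨hWF.1, Or.inr ⟨y, η, hgr, hη, hM⟩⟩⟩
  · exact ColombeauWF.notMem_WF_of_notMem_nonconstSet hf hv hWF.1 hK ξ₀ hWF
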